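/- For $m\in\mathbb N$, $m\ge 1$, and $z>0$ let $T_{\mathrm{intervals}}(z)$ be the binary classification task in $\mathbb R^2$ in which a point $X$ is uniformly distributed on the union of $L_-=[(0,0),(m,0)]$ and $L_+=[(0,z),(m,z)]$, and the ground truth $h$ gives label $-1$ on $L_-$ and $+1$ otherwise. For a classifier $f:\mathbb R^2\to\{-1,1\}$ and $\epsilon\ge 0$ let $AR(f,\epsilon)=\mathbb P_X[\exists\,\gamma:\ \|\gamma\|_2\le\epsilon,\ f(X+\gamma)\ne h(X)]$. An $\epsilon$-perturbation is a measurable map $p:\mathbb R^2\to\mathbb R^2$ with $\|p(x)-x\|_2\le\epsilon$ for all $x$, and $AR(f,p)=\mathbb P_X[f(p(X))\ne h(X)]$. A $q$-bounded adversary with parameter $\epsilon$ is a deterministic (computationally unbounded) procedure $\mathcal A$ that asks at most $q$, possibly adaptive, queries of the form "$f(x)=1$?" and outputs an $\epsilon$-perturbation $\mathcal A(f)$. For a learning algorithm $\mathrm{ALG}$ that receives $n$ i.i.d. points labelled by $h$, let $QC(\mathrm{ALG},T,n,\epsilon,\alpha,\kappa)$ be the least $q\in\mathbb N$ (or $\infty$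 if there is none) for which some $q$-bounded adversary $\mathcal A$ with parameter $\epsilon$ satisfies $AR(\mathrm{ALG}(S),\mathcal A(\mathrm{ALG}(S)))\ge\alpha\cdot AR(\mathrm{ALG}(S),\epsilon)$ with probability at least $1-\kappa$ over the sample $S$. Theorem. There exist a function $\lambda:\mathbb R_{>0}\to(0,1)$ and a constant $z_0>0$ such that for every $z\ge z_0$ there are $c>0$ and $M\in\mathbb N$, depending on $z$, such that for all $m\ge \max(M,1)$ the 1-nearest-neighbour algorithm (with any rule for breaking ties) satisfies $$QC\bigl(1\text{-NN},\,T_{\mathrm{intervals}}(z),\,2m,\,z/10,\,1-\lambda(z),\,0.1\bigr)\ \ge\ c\,m .$$ -/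

import Mathlib

open MeasureTheory

noncomputable section

namespace QueryComplexity

/-- Euclidean space `ℝ^d` with the `ℓ₂` norm. -/
abbrev Point (d : ℕ) : Type := EuclideanSpace ℝ (Fin d)

/-- The labels `{-1, 1}`. -/
abbrev Label : Type := ℤˣ

/-- A classifier `f : ℝ^d → {-1, 1}`. -/
abbrev Classifier (d : ℕ) : Type := Point d → Label

/-- A separable binary classification task on `ℝ^d`: a data distribution and a ground truth. -/
structure Task (d : ℕ) where
  /-- the data distribution -/
  dist : Measure (Point d)
  /-- it is a probability measure -/
  isProb : IsProbabilityMeasure dist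
  /-- the ground truth `h` -/
  truth : Classifier d

/-- An `ε`-perturbation: a (measurable) map that moves every point by at most `ε`. -/
structure Perturbation (d : ℕ) (ε : ℝ) where
  /-- the underlying map -/
  toFun : Point d → Point d
  /-- it is Borel measurable -/
  measurable : Measurable toFun
  /-- no point is moved by more than `ε` -/
  bound : ∀ x, ‖toFun x - x‖ ≤ ε

/-- Adversarial risk `AR(f, ε) = P_X [∃ γ ∈ B_ε, f (X + γ) ≠ h X]`. -/
def advRisk {d : ℕ} (T : Task d) (f : Classifier d) (ε : ℝ) : ℝ :=
  T.dist.real {x | ∃ γ : Point d, ‖γ‖ ≤ ε ∧ f (x + γ) ≠ T.truth x}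

/-- Adversarial risk of a specific perturbation, `AR(f, p) = P_X [f (p X) ≠ h X]`. -/
def advRiskOf {d : ℕ} {ε : ℝ} (T : Task d) (f : Classifier d) (p : Perturbation d ε) : ℝ :=
  T.dist.real {x | f (p.toFun x) ≠ T.truth x}

/-- A deterministic adaptive adversary with parameter `ε`: either it stops and outputs an
`ε`-perturbation, or it asks the query `f x = 1` for a point `x` of its choice and continues
according to the answer. It is not limited computationally. -/
inductive Adversary (d : ℕ) (ε : ℝ) : Type
  | output (p : Perturbation d ε) : Adversary d ε
  | ask (x : Point d) (yes no : Adversary d ε) : Adversary d ε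

/-- The perturbation that the adversary outputs when it interacts with the classifier `f`. -/
def Adversary.run {d : ℕ} {ε : ℝ} : Adversary d ε → Classifier d → Perturbation d ε
  | .output p, _ => p
  | .ask x yes no, f => if f x = 1 then yes.run f else no.run f

/-- The maximal number of queries that the adversary asks. -/
def Adversary.queries {d : ℕ} {ε : ℝ} : Adversary d ε → ℕ
  | .output _ => 0
  | .ask _ yes no => max yes.queries no.queries + 1

/-- A (deterministic) learning algorithm: it turns a labelled sample into a classifier. -/
abbrev LearningAlgorithm (d : ℕ) : Type :=
  (n : ℕ) → (Fin n → Point d × Label) → Classifier d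

/-- The classifier learned from the points `x 1, …, x n`, labelled by the ground truth. -/
def Task.learn {d : ℕ} (T : Task d) (A : LearningAlgorithm d) {n : ℕ} (x : Fin n → Point d) :
    Classifier d :=
  A n fun i => (x i, T.truth (x i))

/-- The adversary succeeds against `A` on the task `T` with sample size `n`, approximation
constant `α` and error probability `κ`: for `S ∼ D^n` the probability of
`AR(A(S), 𝒜(A(S))) ≥ α · AR(A(S), ε)` is at least `1 - κ`. -/
def Adversary.Succeeds {d : ℕ} {ε : ℝ} (𝒜 : Adversary d ε) (A : LearningAlgorithm d) (T : Task d)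
    (n : ℕ) (α κ : ℝ) : Prop :=
  1 - κ ≤ (Measure.pi fun _ : Fin n => T.dist).real
    {S | α * advRisk T (T.learn A S) ε ≤ advRiskOf T (T.learn A S) (𝒜.run (T.learn A S))}

/-- Query complexity `QC(A, T, n, ε, α, κ)`: the least `q` such that some adversary with parameter
`ε` that asks at most `q` queries succeeds (`⊤` if there is no such `q`). -/
def QC {d : ℕ} (A : LearningAlgorithm d) (T : Task d) (n : ℕ) (ε α κ : ℝ) : ℕ∞ :=
  ⨅ q ∈ {q : ℕ | ∃ 𝒜 : Adversary d ε, 𝒜.queries ≤ q ∧ 𝒜.Succeeds A T n α κ}, (q : ℕ∞)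

/-- `A` is the 1-nearest-neighbour algorithm, with some way of breaking ties: for every nonempty
sample, each point receives the label of a sample point that is closest to it. -/
def IsOneNN {d : ℕ} (A : LearningAlgorithm d) : Prop :=
  ∀ (n : ℕ) (S : Fin n → Point d × Label) (x : Point d), 0 < n →
    ∃ i, (∀ j, dist x (S i).1 ≤ dist x (S j).1) ∧ A n S x = (S i).2

/-- The uniform distribution on the union of `[(0, 0), (m, 0)]` and `[(0, z), (m, z)]`: arc length
on the two segments, normalized by the total length `2 * m`. -/
def intervalsDist (m : ℕ) (z : ℝ) : Measure (Point 2) :=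
  (2 * m : ENNReal)⁻¹ •
    ((volume.restrict (Set.Icc (0 : ℝ) m)).map (fun t => (!₂[t, 0] : Point 2)) +
      (volume.restrict (Set.Icc (0 : ℝ) m)).map (fun t => (!₂[t, z] : Point 2)))

theorem intervalsDist_isProb (m : ℕ) (hm : 0 < m) (z : ℝ) :
    IsProbabilityMeasure (intervalsDist m z) := by
  have h (y : ℝ) : Measurable fun t : ℝ => (!₂[t, y] : Point 2) := by
    apply Continuous.measurable
    refine (PiLp.continuous_toLp 2 _).comp (continuous_pi fun i => ?_)
    fin_cases i
    · exact continuous_id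
    · exact continuous_const
  refine ⟨?_⟩
  simp only [intervalsDist, Measure.smul_apply, Measure.add_apply, smul_eq_mul]
  rw [Measure.map_apply (h 0) .univ, Measure.map_apply (h z) .univ]
  simp only [Set.preimage_univ, Measure.restrict_apply_univ, Real.volume_Icc, sub_zero,
    ENNReal.ofReal_natCast, ← two_mul]
  exact ENNReal.inv_mul_cancel (by simp; omega)
    (ENNReal.mul_ne_top (by simp) (ENNReal.natCast_ne_top m))

open Classical in
/-- The task of the two parallel intervals of length `m` at distance `z`: the points are uniform on
the union of the two intervals, the label is `-1` on `[(0, 0), (m, 0)]` and `+1` otherwise. -/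
def intervalsTask (m : ℕ) (hm : 0 < m) (z : ℝ) : Task 2 where
  dist := intervalsDist m z
  isProb := intervalsDist_isProb m hm z
  truth := fun x => if x ∈ segment ℝ (!₂[0, 0] : Point 2) !₂[(m : ℝ), 0] then -1 else 1

end QueryComplexity

end

/-! Put `z = 100 * s`, so the perturbation budget is `10 * s`, and cut the lines into windows of
length `210 * s`. The `2 * m` sample points have unit density, so a window shows the pattern `Good`
with probability bounded away from zero: around its midpoint the lower line is empty except for one
cluster at distance about `88 * s`, on the left or on the right, while the upper line has points on
both sides close to the midpoint. A lower point near the midpoint can be pushed into the region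
labelled `+1` on the side away from the cluster, but never on the side of the cluster. A
perturbation that does not know the side has to guess.

Learning the side costs a query in that window. The guard points near the ends of the window shield
the rest of the plane, so mirroring the cluster leaves the classifier unchanged outside the vertical
strip over the window (`canon_flip`). Let `V` be the set of good windows without a query. Mirroring
the clusters of all windows of `V` is a measure-preserving involution on the samples with this `V`,
and it keeps the answers, the output perturbation and `V` itself (`run_flip`, `freshGood_flip`). At
each point near a midpoint the common perturbation misses for the sample or for its mirror image
(`Good.canon_eq_neg_one_or`). Hence the two losses add up to at least the mass of these points, and
given `V` the loss is at least half of it with probability at least one half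
(`two_mul_measure_loss_lt`).

By a second moment bound the number of good windows is at least a fixed multiple of `m` with
probability at least `9 / 10` (`eventually_card_good`). Each query spoils at most one window. So few
queries leave a constant loss with probability at least `4 / 10`, more than the permitted failure
probability `1 / 10`.

The tie-breaking rule is arbitrary and possibly nonmeasurable. The argument therefore runs on the
measurable classifier `canon`, which almost surely gives the adversary the same answers
(`ae_run_learn_eq`). -/

noncomputable section

namespace QueryComplexity

/-! ### Windows and the measure-preserving reflection of their clusters -/

/-- The index of the window of length `210 * s` that contains `t`. -/
def windowIndex (s t : ℝ) : ℤ := ⌊t / (210 * s)⌋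

/-- The midpoint of the window with index `i`. -/
def windowCenter (s : ℝ) (i : ℤ) : ℝ := 210 * s * i + 105 * s

/-- The offset of `t` from the midpoint of the window `i`. -/
def offset (s : ℝ) (i : ℤ) (t : ℝ) : ℝ := t - windowCenter s i

theorem windowIndex_eq_iff {s : ℝ} (hs : 0 < s) {t : ℝ} {i : ℤ} :
    windowIndex s t = i ↔ -(105 * s) ≤ offset s i t ∧ offset s i t < 105 * s := by
  have h : 0 < 210 * s := by positivity
  rw [windowIndex, Int.floor_eq_iff, le_div_iff₀ h, div_lt_iff₀ h, offset, windowCenter]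
  constructor <;> rintro ⟨h1, h2⟩ <;> constructor <;> linarith

theorem measurable_windowIndex (s : ℝ) : Measurable (windowIndex s) :=
  Int.measurable_floor.comp (measurable_id.div_const _)

/-- Reflect the points at offset between `87 * s` and `89 * s`, in the windows of `V`. -/
def reflect (s : ℝ) (V : Finset ℤ) (t : ℝ) : ℝ :=
  if windowIndex s t ∈ V ∧ 87 * s ≤ |offset s (windowIndex s t) t| ∧
      |offset s (windowIndex s t) t| ≤ 89 * s
  then 2 * windowCenter s (windowIndex s t) - t else t

theorem offset_two_mul_sub (s : ℝ) (i : ℤ) (t : ℝ) :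
    offset s i (2 * windowCenter s i - t) = -offset s i t := by
  simp only [offset]; ring

theorem reflect_of_mem {s : ℝ} (hs : 0 < s) {V : Finset ℤ} {i : ℤ} (hi : i ∈ V) {t : ℝ}
    (h1 : 87 * s ≤ |offset s i t|) (h2 : |offset s i t| ≤ 89 * s) :
    reflect s V t = 2 * windowCenter s i - t := by
  have h : windowIndex s t = i :=
    (windowIndex_eq_iff hs).2 (by rw [abs_le] at h2; constructor <;> linarith)
  subst h
  rw [reflect, if_pos ⟨hi, h1, h2⟩]

theorem reflect_eq_self {s : ℝ} {V : Finset ℤ} {t : ℝ} {i : ℤ} (hi : windowIndex s t = i)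
    (h : ¬(87 * s ≤ |offset s i t| ∧ |offset s i t| ≤ 89 * s)) : reflect s V t = t := by
  subst hi
  rw [reflect, if_neg fun h' => h h'.2]

theorem reflect_eq_self_of_notMem {s : ℝ} {V : Finset ℤ} {t : ℝ}
    (h : windowIndex s t ∉ V) : reflect s V t = t := by
  rw [reflect, if_neg fun h' => h h'.1]

theorem reflect_cases {s : ℝ} (V : Finset ℤ) (t : ℝ) :
    reflect s V t = t ∨ ∃ i ∈ V, windowIndex s t = i ∧ 87 * s ≤ |offset s i t| ∧
      |offset s i t| ≤ 89 * s ∧ offset s i (reflect s V t) = -offset s i t := by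
  by_cases h : windowIndex s t ∈ V ∧ 87 * s ≤ |offset s (windowIndex s t) t| ∧
      |offset s (windowIndex s t) t| ≤ 89 * s
  · refine .inr ⟨_, h.1, rfl, h.2.1, h.2.2, ?_⟩
    rw [reflect, if_pos h, offset_two_mul_sub]
  · rw [reflect, if_neg h]; exact .inl rfl

theorem windowIndex_reflect {s : ℝ} (hs : 0 < s) (V : Finset ℤ) (t : ℝ) :
    windowIndex s (reflect s V t) = windowIndex s t := by
  obtain h | ⟨i, -, hi, -, h2, h3⟩ := reflect_cases (s := s) V t
  · rw [h]
  · rw [hi, windowIndex_eq_iff hs, h3]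
    rw [abs_le] at h2
    constructor <;> linarith

theorem abs_offset_reflect {s : ℝ} {V : Finset ℤ} {t : ℝ} {i : ℤ}
    (hi : windowIndex s t = i) : |offset s i (reflect s V t)| = |offset s i t| := by
  obtain h | ⟨j, -, hj, -, -, h3⟩ := reflect_cases (s := s) V t
  · rw [h]
  · rw [← hi, hj, h3, abs_neg]

theorem reflect_reflect {s : ℝ} (hs : 0 < s) (V : Finset ℤ) (t : ℝ) :
    reflect s V (reflect s V t) = t := by
  obtain h | ⟨i, hi, hit, h1, h2, h3⟩ := reflect_cases (s := s) V t
  · rw [h, h]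
  · rw [reflect_of_mem hs hi (by rwa [h3, abs_neg]) (by rwa [h3, abs_neg]),
      reflect_of_mem hs hi h1 h2]
    ring

theorem measurable_offset (s : ℝ) (i : ℤ) : Measurable (offset s i) :=
  measurable_id.sub_const _

theorem measurableSet_cluster (s : ℝ) (i : ℤ) :
    MeasurableSet {t | 87 * s ≤ |offset s i t| ∧ |offset s i t| ≤ 89 * s} :=
  (measurableSet_le measurable_const (measurable_offset s i).abs).inter
    (measurableSet_le (measurable_offset s i).abs measurable_const)

theorem reflect_empty (s : ℝ) : reflect s ∅ = id := by
  ext t; simp [reflect]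

/-- A reflection never leaves its window, so different windows do not interact. The factorization
reduces measure preservation to a single window. -/
theorem reflect_insert {s : ℝ} (hs : 0 < s) {V : Finset ℤ} {i : ℤ} (hi : i ∉ V) :
    reflect s (insert i V) = reflect s {i} ∘ reflect s V := by
  ext t
  simp only [Function.comp]
  obtain h | ⟨j, hj, hjt, h1, h2, h3⟩ := reflect_cases (s := s) V t
  · rw [h]
    obtain h' | ⟨j, hj, hjt, h1, h2, -⟩ := reflect_cases (s := s) (insert i V) t
    · rw [h']
      by_cases hit : windowIndex s t = i
      · subst hit
        simp only [reflect, Finset.mem_insert, true_or, true_and, Finset.mem_singleton] at h' ⊢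
        exact h'.symm
      · rw [reflect_eq_self_of_notMem (by simpa using hit)]
    · rw [reflect_of_mem hs hj h1 h2]
      rcases Finset.mem_insert.1 hj with rfl | hj
      · rw [reflect_of_mem hs (Finset.mem_singleton_self _) h1 h2]
      · rw [reflect_of_mem hs hj h1 h2] at h
        rw [reflect_eq_self_of_notMem (by rw [hjt]; rintro h; simp at h; exact hi (h ▸ hj)), h]
  · rw [reflect_of_mem hs (Finset.mem_insert_of_mem hj) h1 h2, reflect_eq_self_of_notMem,
      reflect_of_mem hs hj h1 h2]
    rw [windowIndex_reflect hs, hjt]; rintro h; simp at h; exact hi (h ▸ hj)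

/-- The map is `t ↦ 2 * c - t` on a set symmetric about the midpoint `c`, and the identity off it.
Each piece preserves Lebesgue measure and maps its part of `I` to itself. -/
theorem measurePreserving_reflect_singleton {s : ℝ} (hs : 0 < s) (i : ℤ) (I : Set ℝ)
    (hI : MeasurableSet I) (h : ∀ t, windowIndex s t = i → t ∈ I) :
    MeasurePreserving (reflect s {i}) (volume.restrict I) (volume.restrict I) := by
  set B := {t | 87 * s ≤ |offset s i t| ∧ |offset s i t| ≤ 89 * s} with hB
  have hBm : MeasurableSet B := measurableSet_cluster s i
  have hBI : B ⊆ I := fun t ht => h t ((windowIndex_eq_iff hs).2 (by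
    have := abs_le.1 ht.2; constructor <;> linarith))
  have heq : reflect s {i} = B.piecewise (fun t => 2 * windowCenter s i - t) id := by
    ext t
    by_cases ht : t ∈ B
    · rw [Set.piecewise_eq_of_mem _ _ _ ht,
        reflect_of_mem hs (Finset.mem_singleton_self _) ht.1 ht.2]
    · rw [Set.piecewise_eq_of_notMem _ _ _ ht]
      by_cases hi : windowIndex s t = i
      · exact reflect_eq_self hi ht
      · exact reflect_eq_self_of_notMem (by simpa using hi)
  have hφ : MeasurePreserving (fun t => 2 * windowCenter s i - t) :=
    Measure.measurePreserving_sub_left volume _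
  have hm : Measurable (reflect s {i}) := by
    rw [heq]; exact hφ.measurable.piecewise hBm measurable_id
  refine ⟨hm, ?_⟩
  ext A hA
  rw [Measure.map_apply hm hA, Measure.restrict_apply (hm hA), Measure.restrict_apply hA,
    ← measure_inter_add_sdiff (_ ∩ I) hBm, ← measure_inter_add_sdiff (A ∩ I) hBm]
  congr 1
  · have : reflect s {i} ⁻¹' A ∩ I ∩ B = (fun t => 2 * windowCenter s i - t) ⁻¹' (A ∩ I ∩ B) := by
      ext t
      have hBφ : 2 * windowCenter s i - t ∈ B ↔ t ∈ B := by
        simp only [hB, Set.mem_ofPred_eq, offset_two_mul_sub, abs_neg]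
      simp only [Set.mem_inter_iff, Set.mem_preimage, hBφ]
      constructor
      · rintro ⟨⟨h1, h2⟩, h3⟩
        rw [heq, Set.piecewise_eq_of_mem _ _ _ h3] at h1
        exact ⟨⟨h1, hBI (hBφ.2 h3)⟩, h3⟩
      · rintro ⟨⟨h1, h2⟩, h3⟩
        rw [heq, Set.piecewise_eq_of_mem _ _ _ h3]
        exact ⟨⟨h1, hBI h3⟩, h3⟩
    rw [this, hφ.measure_preimage ((hA.inter hI).inter hBm).nullMeasurableSet]
  · congr 1
    ext t
    simp only [Set.mem_sdiff, Set.mem_inter_iff, Set.mem_preimage]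
    refine and_congr_left fun h3 => and_congr_left fun _ => ?_
    rw [heq, Set.piecewise_eq_of_notMem _ _ _ h3, id]

theorem measurePreserving_reflect {s : ℝ} (hs : 0 < s) (V : Finset ℤ) (I : Set ℝ)
    (hI : MeasurableSet I) (h : ∀ t, windowIndex s t ∈ V → t ∈ I) :
    MeasurePreserving (reflect s V) (volume.restrict I) (volume.restrict I) := by
  induction V using Finset.induction_on with
  | empty => rw [reflect_empty]; exact MeasurePreserving.id _
  | insert i V hi ih =>
    rw [reflect_insert hs hi]
    exact (measurePreserving_reflect_singleton hs i I hI fun t ht => h t (by simp [ht])).comp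
      (ih fun t ht => h t (by simp [ht]))

/-- Apply `reflect` on the lower line. -/
def flip (s : ℝ) (V : Finset ℤ) (x : Point 2) : Point 2 :=
  if x 1 = 0 then !₂[reflect s V (x 0), 0] else x

@[simp] theorem flip_one (s : ℝ) (V : Finset ℤ) (x : Point 2) : flip s V x 1 = x 1 := by
  unfold flip; split_ifs with h <;> simp [h]

theorem flip_of_ne {s : ℝ} {V : Finset ℤ} {x : Point 2} (h : x 1 ≠ 0) : flip s V x = x :=
  if_neg h

theorem flip_zero {s : ℝ} {V : Finset ℤ} {x : Point 2} (h : x 1 = 0) :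
    flip s V x 0 = reflect s V (x 0) := by
  simp [flip, h]

theorem flip_flip {s : ℝ} (hs : 0 < s) (V : Finset ℤ) (x : Point 2) :
    flip s V (flip s V x) = x := by
  by_cases h : x 1 = 0
  · ext k
    fin_cases k
    · simp [flip, h, reflect_reflect hs]
    · simp
  · rw [flip_of_ne h, flip_of_ne h]

theorem measurable_mk_point {α : Type*} [MeasurableSpace α] {f g : α → ℝ} (hf : Measurable f)
    (hg : Measurable g) : Measurable fun a => (!₂[f a, g a] : Point 2) := by
  refine (PiLp.continuous_toLp 2 _).measurable.comp (measurable_pi_lambda _ fun i => ?_)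
  fin_cases i
  · exact hf
  · exact hg

theorem measurable_coord (k : Fin 2) : Measurable fun x : Point 2 => x k :=
  (EuclideanSpace.proj (𝕜 := ℝ) k).continuous.measurable

theorem measurePreserving_flip {s z : ℝ} (hs : 0 < s) (hz : 0 < z) (V : Finset ℤ) (m : ℕ)
    (h : ∀ t, windowIndex s t ∈ V → t ∈ Set.Icc (0 : ℝ) m) :
    MeasurePreserving (flip s V) (intervalsDist m z) (intervalsDist m z) := by
  have hr := measurePreserving_reflect hs V (Set.Icc (0 : ℝ) m) measurableSet_Icc h
  have hm : Measurable (flip s V) :=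
    Measurable.ite (measurable_coord 1 (measurableSet_singleton 0))
      (measurable_mk_point
        ((measurePreserving_reflect hs V Set.univ .univ fun _ _ => trivial).measurable.comp
          (measurable_coord 0)) measurable_const) measurable_id
  have he (y : ℝ) : Measurable fun t : ℝ => (!₂[t, y] : Point 2) :=
    measurable_mk_point measurable_id measurable_const
  refine ⟨hm, ?_⟩
  rw [intervalsDist, Measure.map_smul, Measure.map_add _ _ hm, Measure.map_map hm (he 0),
    Measure.map_map hm (he z)]
  congr 2
  · have : flip s V ∘ (fun t : ℝ => (!₂[t, 0] : Point 2)) = (fun t => !₂[t, 0]) ∘ reflect s V := by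
      ext t; simp [flip]
    rw [this, ← Measure.map_map (he 0) hr.measurable, hr.map_eq]
  · congr 1
    ext t; simp [flip, hz.ne']

/-! ### The nearest-neighbour classifier with fixed ties, and good windows -/

theorem dist_le_dist_iff_sq {x y p q : Point 2} :
    dist x p ≤ dist y q ↔
      (x 0 - p 0) ^ 2 + (x 1 - p 1) ^ 2 ≤ (y 0 - q 0) ^ 2 + (y 1 - q 1) ^ 2 := by
  rw [EuclideanSpace.dist_eq, EuclideanSpace.dist_eq, Real.sqrt_le_sqrt_iff (by positivity)]
  simp [Fin.sum_univ_two, Real.dist_eq, sq_abs]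

theorem dist_lt_dist_iff_sq {x y p q : Point 2} :
    dist x p < dist y q ↔
      (x 0 - p 0) ^ 2 + (x 1 - p 1) ^ 2 < (y 0 - q 0) ^ 2 + (y 1 - q 1) ^ 2 := by
  rw [← not_le, dist_le_dist_iff_sq, not_le]

theorem norm_le_iff_sq {x : Point 2} {r : ℝ} (hr : 0 ≤ r) :
    ‖x‖ ≤ r ↔ x 0 ^ 2 + x 1 ^ 2 ≤ r ^ 2 := by
  rw [EuclideanSpace.norm_eq, Real.sqrt_le_left hr]
  simp [Fin.sum_univ_two, sq_abs]

open Classical in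
/-- The nearest-neighbour classifier of a sample on the lines at height `0` and `z`, where ties
between the lines are broken in favour of the label `1`. -/
def canon (z : ℝ) {n : ℕ} (S : Fin n → Point 2) : Classifier 2 := fun y =>
  if ∃ k, S k 1 = z ∧ ∀ j, S j 1 = 0 → dist y (S k) ≤ dist y (S j) then 1 else -1

theorem canon_eq_one {z : ℝ} {n : ℕ} {S : Fin n → Point 2} {y : Point 2} :
    canon z S y = 1 ↔ ∃ k, S k 1 = z ∧ ∀ j, S j 1 = 0 → dist y (S k) ≤ dist y (S j) := by
  unfold canon; split_ifs with h <;> simp [h]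

theorem canon_eq_neg_one {z : ℝ} {n : ℕ} {S : Fin n → Point 2} {y : Point 2} :
    canon z S y = -1 ↔ ∀ k, S k 1 = z → ∃ j, S j 1 = 0 ∧ dist y (S j) < dist y (S k) := by
  unfold canon; split_ifs with h
  · simp only [show (1 : Label) ≠ -1 by decide, false_iff]
    push Not; exact h
  · simp only [true_iff]; push Not at h; exact h

/-- The sample `S` has a point at height `y` with offset from `lo` to `hi` in the window `i`. -/
def Occupied {n : ℕ} (s : ℝ) (S : Fin n → Point 2) (i : ℤ) (y lo hi : ℝ) : Prop :=
  ∃ k, S k 1 = y ∧ lo * s ≤ offset s i (S k 0) ∧ offset s i (S k 0) ≤ hi * s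

/-- The window `i` shows the pattern in which the risk depends on the side of a cluster. -/
structure Good {n : ℕ} (s : ℝ) (S : Fin n → Point 2) (i : ℤ) : Prop where
  guard_left : Occupied s S i 0 (-103) (-101)
  guard_right : Occupied s S i 0 101 103
  upper_left : Occupied s S i (100 * s) (-9) (-5)
  upper_right : Occupied s S i (100 * s) 5 9
  gap : ∀ k, S k 1 = 0 → |offset s i (S k 0)| < 101 * s →
    87 * s ≤ |offset s i (S k 0)| ∧ |offset s i (S k 0)| ≤ 89 * s
  cluster : (Occupied s S i 0 (-89) (-87) ∧ ¬Occupied s S i 0 87 89) ∨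
    (¬Occupied s S i 0 (-89) (-87) ∧ Occupied s S i 0 87 89)

/-- Apply `flip` to every sample point. -/
def flipSample {n : ℕ} (s : ℝ) (V : Finset ℤ) (S : Fin n → Point 2) : Fin n → Point 2 :=
  fun k => flip s V (S k)

/-! ### What the reflection of clusters preserves -/

section flipSample

variable {n : ℕ} {s : ℝ} {V : Finset ℤ} {S : Fin n → Point 2} {i : ℤ}

theorem flipSample_flipSample (hs : 0 < s) : flipSample s V (flipSample s V S) = S :=
  funext fun k => flip_flip hs V (S k)

theorem flipSample_ne {k : Fin n} (h : S k 1 ≠ 0) : flipSample s V S k = S k :=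
  flip_of_ne h

@[simp] theorem flipSample_one (k : Fin n) : flipSample s V S k 1 = S k 1 :=
  flip_one s V (S k)

theorem flipSample_zero {k : Fin n} (h : S k 1 = 0) :
    flipSample s V S k 0 = reflect s V (S k 0) := flip_zero h

theorem Occupied.flip_upper (hs : 0 < s) {lo hi : ℝ} (h : Occupied s S i (100 * s) lo hi) :
    Occupied s (flipSample s V S) i (100 * s) lo hi := by
  obtain ⟨k, h1, h2⟩ := h
  refine ⟨k, by simpa using h1, ?_⟩
  rwa [flipSample_ne]
  rw [h1]; positivity

theorem Occupied.flip_of_ne {lo hi : ℝ} (h : Occupied s S i 0 lo hi)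
    (h' : ∀ t, lo * s ≤ offset s i t → offset s i t ≤ hi * s → reflect s V t = t) :
    Occupied s (flipSample s V S) i 0 lo hi := by
  obtain ⟨k, h1, h2, h3⟩ := h
  refine ⟨k, by simpa using h1, ?_⟩
  rw [flipSample_zero h1, h' _ h2 h3]
  exact ⟨h2, h3⟩

theorem Occupied.flip_cluster (hs : 0 < s) (hi : i ∈ V) :
    (Occupied s S i 0 (-89) (-87) → Occupied s (flipSample s V S) i 0 87 89) ∧
    (Occupied s S i 0 87 89 → Occupied s (flipSample s V S) i 0 (-89) (-87)) := by
  constructor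
  · rintro ⟨k, h1, h2, h3⟩
    refine ⟨k, by simpa using h1, ?_⟩
    have h : |offset s i (S k 0)| = -offset s i (S k 0) := abs_of_nonpos (by linarith)
    rw [flipSample_zero h1, reflect_of_mem hs hi (by linarith) (by linarith), offset_two_mul_sub]
    constructor <;> linarith
  · rintro ⟨k, h1, h2, h3⟩
    refine ⟨k, by simpa using h1, ?_⟩
    have h : |offset s i (S k 0)| = offset s i (S k 0) := abs_of_nonneg (by linarith)
    rw [flipSample_zero h1, reflect_of_mem hs hi (by linarith) (by linarith), offset_two_mul_sub]
    constructor <;> linarith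

theorem occupied_flip_cluster_iff (hs : 0 < s) (hi : i ∈ V) :
    (Occupied s (flipSample s V S) i 0 87 89 ↔ Occupied s S i 0 (-89) (-87)) ∧
    (Occupied s (flipSample s V S) i 0 (-89) (-87) ↔ Occupied s S i 0 87 89) := by
  refine ⟨⟨fun h => ?_, (Occupied.flip_cluster hs hi).1⟩,
    ⟨fun h => ?_, (Occupied.flip_cluster hs hi).2⟩⟩
  · simpa only [flipSample_flipSample hs] using (Occupied.flip_cluster hs hi).2 h
  · simpa only [flipSample_flipSample hs] using (Occupied.flip_cluster hs hi).1 h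

theorem occupied_flip_iff_of_notMem (hs : 0 < s) (hi : i ∉ V) {lo hi : ℝ} (hlo : -105 < lo)
    (hhi : hi < 105) :
    Occupied s (flipSample s V S) i 0 lo hi ↔ Occupied s S i 0 lo hi := by
  have key : ∀ t, lo * s ≤ offset s i t → offset s i t ≤ hi * s → reflect s V t = t :=
    fun t h1 h2 => reflect_eq_self_of_notMem (by
      rwa [(windowIndex_eq_iff hs).2 ⟨by nlinarith, by nlinarith⟩])
  refine ⟨fun h => ?_, fun h => h.flip_of_ne key⟩
  simpa only [flipSample_flipSample hs] using h.flip_of_ne (V := V) key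

/-- The pattern is symmetric: guards and upper points do not move, the gap condition involves only
`|offset|`, and the two alternatives for the cluster are exchanged. -/
theorem Good.flip (hs : 0 < s) (h : Good s S i) : Good s (flipSample s V S) i where
  guard_left := h.guard_left.flip_of_ne fun t h1 h2 =>
    reflect_eq_self ((windowIndex_eq_iff hs).2 ⟨by linarith, by linarith⟩)
      fun h => by rw [abs_of_nonpos (by linarith)] at h; linarith
  guard_right := h.guard_right.flip_of_ne fun t h1 h2 =>
    reflect_eq_self ((windowIndex_eq_iff hs).2 ⟨by linarith, by linarith⟩)
      fun h => by rw [abs_of_nonneg (by linarith)] at h; linarith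
  upper_left := h.upper_left.flip_upper hs
  upper_right := h.upper_right.flip_upper hs
  gap := fun k hk hlt => by
    rw [flipSample_one] at hk
    rw [flipSample_zero hk] at hlt ⊢
    have hi : windowIndex s (S k 0) = i := by
      rw [← windowIndex_reflect hs V, windowIndex_eq_iff hs]
      rw [abs_lt] at hlt
      constructor <;> linarith
    rw [abs_offset_reflect hi] at hlt ⊢
    exact h.gap k hk hlt
  cluster := by
    by_cases hi : i ∈ V
    · rw [(occupied_flip_cluster_iff hs hi).1, (occupied_flip_cluster_iff hs hi).2]
      rcases h.cluster with h | h
      · exact .inr h.symm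
      · exact .inl h.symm
    · rw [occupied_flip_iff_of_notMem hs hi (by norm_num) (by norm_num),
        occupied_flip_iff_of_notMem hs hi (by norm_num) (by norm_num)]
      exact h.cluster

theorem good_flip_iff (hs : 0 < s) : Good s (flipSample s V S) i ↔ Good s S i :=
  ⟨fun h => by simpa only [flipSample_flipSample hs] using h.flip (V := V) hs, fun h => h.flip hs⟩

/-- A reflected point stays within offset `89 * s`, so seen from outside the window it lies behind
the guard on that side. The guard already belongs to `S` and is no closer to `y` than the winning
upper point, so the reflected point cannot win either. -/
theorem canon_flip_of_eq_one (hs : 0 < s) (hV : ∀ i ∈ V, Good s S i) {y : Point 2}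
    (hy : windowIndex s (y 0) ∉ V) (h : canon (100 * s) S y = 1) :
    canon (100 * s) (flipSample s V S) y = 1 := by
  rw [canon_eq_one] at h ⊢
  obtain ⟨k, hk, h⟩ := h
  refine ⟨k, by simpa using hk, fun j hj => ?_⟩
  rw [flipSample_ne (by rw [hk]; positivity)]
  rw [flipSample_one] at hj
  obtain hr | ⟨i, hi, -, h1, h2, h3⟩ := reflect_cases (s := s) V (S j 0)
  · refine (h j hj).trans (le_of_eq ?_)
    congr 1
    ext l
    fin_cases l
    · simp [flipSample_zero hj, hr]
    · simp
  · have hout : offset s i (y 0) < -(105 * s) ∨ 105 * s ≤ offset s i (y 0) := by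
      by_contra hc
      push Not at hc
      exact hy ((windowIndex_eq_iff hs).2 hc ▸ hi)
    rw [← abs_neg, ← h3, abs_le] at h2
    rcases hout with ho | ho
    · obtain ⟨l, hl, hl1, hl2⟩ := (hV i hi).guard_left
      refine (h l hl).trans (dist_le_dist_iff_sq.2 ?_)
      rw [flipSample_zero hj, flipSample_one, hj, hl]
      simp only [offset] at *
      nlinarith
    · obtain ⟨l, hl, hl1, hl2⟩ := (hV i hi).guard_right
      refine (h l hl).trans (dist_le_dist_iff_sq.2 ?_)
      rw [flipSample_zero hj, flipSample_one, hj, hl]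
      simp only [offset] at *
      nlinarith

/-- The implication for the label `1` suffices, because the reflection is an involution that
preserves good windows. -/
theorem canon_flip (hs : 0 < s) (hV : ∀ i ∈ V, Good s S i) {y : Point 2}
    (hy : windowIndex s (y 0) ∉ V) :
    canon (100 * s) (flipSample s V S) y = canon (100 * s) S y := by
  by_cases h : canon (100 * s) S y = 1
  · rw [h, canon_flip_of_eq_one hs hV hy h]
  · have h' : canon (100 * s) (flipSample s V S) y ≠ 1 := fun h' => h (by
      simpa only [flipSample_flipSample hs] using
        canon_flip_of_eq_one hs (fun i hi => (hV i hi).flip hs) hy h')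
    rw [(Int.units_eq_one_or _).resolve_left h, (Int.units_eq_one_or _).resolve_left h']

end flipSample

/-! ### Risk near the midpoint of a good window -/

section risk

variable {n : ℕ} {s : ℝ} {S : Fin n → Point 2} {i : ℤ}

/-- On the cluster's side the horizontal distance to the cluster is at most `89 * s`. As `y 1 ≤ 10 *
s`, the upper line is farther than the lower one by at least `8000 * s ^ 2` in squared vertical
distance, and `89 ^ 2 = 7921 < 8000`. -/
theorem canon_eq_neg_one_of_cluster_left (hs : 0 < s) {x y : Point 2}
    (hc : Occupied s S i 0 (-89) (-87))
    (hx1 : x 1 = 0) (hx : |offset s i (x 0)| ≤ 7 / 10 * s) (hxy : ‖y - x‖ ≤ 10 * s)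
    (hy : offset s i (y 0) ≤ 0) : canon (100 * s) S y = -1 := by
  obtain ⟨j, hj, hj1, hj2⟩ := hc
  refine canon_eq_neg_one.2 fun k hk => ⟨j, hj, dist_lt_dist_iff_sq.2 ?_⟩
  rw [norm_le_iff_sq (by positivity)] at hxy
  simp only [PiLp.sub_apply, hx1, sub_zero] at hxy
  have h0 : |y 0 - x 0| ≤ 10 * s := abs_le_of_sq_le_sq (by nlinarith [sq_nonneg (y 1)]) (by positivity)
  have h1 : |y 1| ≤ 10 * s := abs_le_of_sq_le_sq (by nlinarith [sq_nonneg (y 0 - x 0)]) (by positivity)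
  rw [abs_le] at h0 h1 hx
  rw [hj, hk]
  simp only [offset] at *
  have h2 : (y 0 - S j 0) ^ 2 ≤ (89 * s) ^ 2 := sq_le_sq' (by linarith) (by linarith)
  nlinarith [sq_nonneg (y 0 - S k 0)]

theorem canon_eq_neg_one_of_cluster_right (hs : 0 < s) {x y : Point 2}
    (hc : Occupied s S i 0 87 89)
    (hx1 : x 1 = 0) (hx : |offset s i (x 0)| ≤ 7 / 10 * s) (hxy : ‖y - x‖ ≤ 10 * s)
    (hy : 0 ≤ offset s i (y 0)) : canon (100 * s) S y = -1 := by
  obtain ⟨j, hj, hj1, hj2⟩ := hc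
  refine canon_eq_neg_one.2 fun k hk => ⟨j, hj, dist_lt_dist_iff_sq.2 ?_⟩
  rw [norm_le_iff_sq (by positivity)] at hxy
  simp only [PiLp.sub_apply, hx1, sub_zero] at hxy
  have h0 : |y 0 - x 0| ≤ 10 * s := abs_le_of_sq_le_sq (by nlinarith [sq_nonneg (y 1)]) (by positivity)
  have h1 : |y 1| ≤ 10 * s := abs_le_of_sq_le_sq (by nlinarith [sq_nonneg (y 0 - x 0)]) (by positivity)
  rw [abs_le] at h0 h1 hx
  rw [hj, hk]
  simp only [offset] at *
  have h2 : (y 0 - S j 0) ^ 2 ≤ (89 * s) ^ 2 := sq_le_sq' (by linarith) (by linarith)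
  nlinarith [sq_nonneg (y 0 - S k 0)]

/-- In a good window the points near the midpoint are at risk, by a strict margin. -/
theorem Good.exists_near (hs : 0 < s) (h : Good s S i) {x : Point 2}
    (hx1 : x 1 = 0) (hx : |offset s i (x 0)| ≤ 7 / 10 * s) :
    ∃ y : Point 2, ‖y - x‖ ≤ 10 * s ∧
      ∃ k, S k 1 = 100 * s ∧ ∀ j, S j 1 = 0 → dist y (S k) < dist y (S j) := by
  rw [abs_le] at hx
  rcases h.cluster with ⟨-, hn⟩ | ⟨hn, -⟩
  -- The shift fits the budget, as `7.7 ^ 2 + 6 ^ 2 < 10 ^ 2`. In units of `s`, an upper point at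
  -- offset 5 to 9 has squared distance at most `2 ^ 2 + 94 ^ 2`. Every lower point has at least `94
  -- ^ 2 + 6 ^ 2`, where `94 = 7 + 87 = 101 - 7`.
  · refine ⟨!₂[windowCenter s i + 7 * s, 6 * s], ?_, ?_⟩
    · rw [norm_le_iff_sq (by positivity)]
      simp [offset, hx1] at *
      nlinarith
    · obtain ⟨k, hk, hk1, hk2⟩ := h.upper_right
      refine ⟨k, hk, fun j hj => dist_lt_dist_iff_sq.2 ?_⟩
      have hj' : (94 * s) ^ 2 ≤ (7 * s - offset s i (S j 0)) ^ 2 := by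
        rcases lt_or_ge |offset s i (S j 0)| (101 * s) with hlt | hge
        · obtain ⟨h1, h2⟩ := h.gap j hj hlt
          rcases abs_cases (offset s i (S j 0)) with ⟨he, -⟩ | ⟨he, -⟩ <;> rw [he] at h1 h2
          · exact (hn ⟨j, hj, h1, h2⟩).elim
          · exact pow_le_pow_left₀ (by positivity) (by linarith) 2
        · rcases le_abs.1 hge with h1 | h1
          · rw [← neg_sq (7 * s - _)]; exact pow_le_pow_left₀ (by positivity) (by linarith) 2
          · exact pow_le_pow_left₀ (by positivity) (by linarith) 2
      simp [hj, hk, offset] at *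
      nlinarith
  · refine ⟨!₂[windowCenter s i - 7 * s, 6 * s], ?_, ?_⟩
    · rw [norm_le_iff_sq (by positivity)]
      simp [offset, hx1] at *
      nlinarith
    · obtain ⟨k, hk, hk1, hk2⟩ := h.upper_left
      refine ⟨k, hk, fun j hj => dist_lt_dist_iff_sq.2 ?_⟩
      have hj' : (94 * s) ^ 2 ≤ (7 * s + offset s i (S j 0)) ^ 2 := by
        rcases lt_or_ge |offset s i (S j 0)| (101 * s) with hlt | hge
        · obtain ⟨h1, h2⟩ := h.gap j hj hlt
          rcases abs_cases (offset s i (S j 0)) with ⟨he, -⟩ | ⟨he, -⟩ <;> rw [he] at h1 h2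
          · exact pow_le_pow_left₀ (by positivity) (by linarith) 2
          · exact (hn ⟨j, hj, by linarith, by linarith⟩).elim
        · rcases le_abs.1 hge with h1 | h1
          · exact pow_le_pow_left₀ (by positivity) (by linarith) 2
          · rw [← neg_sq (7 * s + _)]; exact pow_le_pow_left₀ (by positivity) (by linarith) 2
      simp [hj, hk, offset] at *
      nlinarith

/-- Whatever point a perturbation picks, it misses for the sample or for its reflection. -/
theorem Good.canon_eq_neg_one_or (hs : 0 < s) {V : Finset ℤ} (hi : i ∈ V) (h : Good s S i)
    {x y : Point 2} (hx1 : x 1 = 0) (hx : |offset s i (x 0)| ≤ 7 / 10 * s)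
    (hxy : ‖y - x‖ ≤ 10 * s) :
    canon (100 * s) S y = -1 ∨ canon (100 * s) (flipSample s V S) y = -1 := by
  have hf := occupied_flip_cluster_iff (S := S) hs hi
  rcases h.cluster with ⟨hc, -⟩ | ⟨-, hc⟩ <;> rcases le_total (offset s i (y 0)) 0 with hy | hy
  · exact .inl (canon_eq_neg_one_of_cluster_left hs hc hx1 hx hxy hy)
  · exact .inr (canon_eq_neg_one_of_cluster_right hs (hf.1.2 hc) hx1 hx hxy hy)
  · exact .inr (canon_eq_neg_one_of_cluster_left hs (hf.2.2 hc) hx1 hx hxy hy)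
  · exact .inl (canon_eq_neg_one_of_cluster_right hs hc hx1 hx hxy hy)

end risk

/-! ### Query transcripts and fresh good windows -/

/-- The points that the adversary queries when it interacts with `f`. -/
def Adversary.queried {d : ℕ} {ε : ℝ} : Adversary d ε → Classifier d → List (Point d)
  | .output _, _ => []
  | .ask x yes no, f => x :: if f x = 1 then yes.queried f else no.queried f

theorem Adversary.length_queried_le {d : ℕ} {ε : ℝ} (𝒜 : Adversary d ε) (f : Classifier d) :
    (𝒜.queried f).length ≤ 𝒜.queries := by
  induction 𝒜 with
  | output p => simp [queried]
  | ask x yes no ih1 ih2 =>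
    simp only [queried, queries, List.length_cons]
    split_ifs <;> omega

/-- Agreement is needed only on the points queried against `f`: equal answers lead down the same
branch of the decision tree. -/
theorem Adversary.run_congr {d : ℕ} {ε : ℝ} {𝒜 : Adversary d ε} {f g : Classifier d}
    (h : ∀ x ∈ 𝒜.queried f, g x = f x) : 𝒜.run g = 𝒜.run f ∧ 𝒜.queried g = 𝒜.queried f := by
  induction 𝒜 with
  | output p => simp [queried, run]
  | ask x yes no ih1 ih2 =>
    simp only [queried, run, List.mem_cons, forall_eq_or_imp] at h ⊢
    rw [h.1]
    split_ifs with hf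
    · rw [if_pos hf] at h
      exact ⟨(ih1 h.2).1, by rw [(ih1 h.2).2]⟩
    · rw [if_neg hf] at h
      exact ⟨(ih2 h.2).1, by rw [(ih2 h.2).2]⟩

open Classical in
/-- The good windows with index less than `K` in which the adversary asks no query. -/
def freshGood {ε : ℝ} (s : ℝ) (K : ℕ) (𝒜 : Adversary 2 ε) {n : ℕ} (S : Fin n → Point 2) :
    Finset ℤ :=
  (Finset.Ico 0 (K : ℤ)).filter fun i =>
    Good s S i ∧ ∀ x ∈ 𝒜.queried (canon (100 * s) S), windowIndex s (x 0) ≠ i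

section fresh

variable {n K : ℕ} {s ε : ℝ} {S : Fin n → Point 2} {𝒜 : Adversary 2 ε} {V : Finset ℤ}

theorem mem_freshGood {i : ℤ} : i ∈ freshGood s K 𝒜 S ↔ (0 ≤ i ∧ i < K) ∧ Good s S i ∧
    ∀ x ∈ 𝒜.queried (canon (100 * s) S), windowIndex s (x 0) ≠ i := by
  simp [freshGood]

theorem run_flip (hs : 0 < s) (hV : freshGood s K 𝒜 S = V) :
    𝒜.run (canon (100 * s) (flipSample s V S)) = 𝒜.run (canon (100 * s) S) ∧
    𝒜.queried (canon (100 * s) (flipSample s V S)) = 𝒜.queried (canon (100 * s) S) := by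
  subst hV
  refine Adversary.run_congr fun x hx => canon_flip hs (fun i hi => (mem_freshGood.1 hi).2.1) ?_
  exact fun h => (mem_freshGood.1 h).2.2 x hx rfl

/-- With transcript and good windows both unchanged, the reflection over `V` maps the event that `V`
is the fresh set to itself. -/
theorem freshGood_flip (hs : 0 < s) (hV : freshGood s K 𝒜 S = V) :
    freshGood s K 𝒜 (flipSample s V S) = V := by
  have h := (run_flip hs hV).2
  ext i
  rw [mem_freshGood, h, good_flip_iff hs, ← mem_freshGood, hV]

-- Every query lies in a single window, so it removes at most one good window.
open Classical in
theorem card_filter_good_le (s : ℝ) (K : ℕ) (𝒜 : Adversary 2 ε) (S : Fin n → Point 2) :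
    ((Finset.Ico 0 (K : ℤ)).filter fun i => Good s S i).card ≤
      (freshGood s K 𝒜 S).card + 𝒜.queries := by
  set l := (𝒜.queried (canon (100 * s) S)).map fun x => windowIndex s (x 0)
  have h : ((Finset.Ico 0 (K : ℤ)).filter fun i => Good s S i) ⊆
      freshGood s K 𝒜 S ∪ l.toFinset := by
    intro i hi
    simp only [Finset.mem_filter, Finset.mem_Ico] at hi
    rw [Finset.mem_union, mem_freshGood]
    by_cases hl : i ∈ l
    · exact .inr (by simpa using hl)
    · refine .inl ⟨hi.1, hi.2, fun x hx he => hl ?_⟩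
      exact List.mem_map.2 ⟨x, hx, he⟩
  calc _ ≤ _ := Finset.card_le_card h
    _ ≤ _ := Finset.card_union_le _ _
    _ ≤ _ := by
      gcongr
      exact (List.toFinset_card_le _).trans
        ((List.length_map _).trans_le (𝒜.length_queried_le _))

end fresh

/-! ### The distribution on the two lines, and ties -/

theorem measurable_mk_right (y : ℝ) : Measurable fun t : ℝ => (!₂[t, y] : Point 2) :=
  measurable_mk_point measurable_id measurable_const

theorem intervalsDist_apply (m : ℕ) (z : ℝ) {E : Set (Point 2)} (hE : MeasurableSet E) :
    intervalsDist m z E = (2 * m : ENNReal)⁻¹ *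
      (volume ({t | (!₂[t, 0] : Point 2) ∈ E} ∩ Set.Icc (0 : ℝ) m) +
        volume ({t | (!₂[t, z] : Point 2) ∈ E} ∩ Set.Icc (0 : ℝ) m)) := by
  rw [intervalsDist, Measure.smul_apply, Measure.add_apply,
    Measure.map_apply (measurable_mk_right 0) hE, Measure.map_apply (measurable_mk_right z) hE,
    Measure.restrict_apply (measurable_mk_right 0 hE),
    Measure.restrict_apply (measurable_mk_right z hE)]
  rfl

/-- The point `x` lies on one of the two segments. -/
def OnLines (m : ℕ) (z : ℝ) (x : Point 2) : Prop :=
  (0 ≤ x 0 ∧ x 0 ≤ m) ∧ (x 1 = 0 ∨ x 1 = z)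

theorem ae_onLines (m : ℕ) (z : ℝ) : ∀ᵐ x ∂intervalsDist m z, OnLines m z x := by
  have hm : MeasurableSet {x : Point 2 | OnLines m z x} :=
    ((measurableSet_le measurable_const (measurable_coord 0)).inter
      (measurableSet_le (measurable_coord 0) measurable_const)).inter
      ((measurable_coord 1 (measurableSet_singleton 0)).union
        (measurable_coord 1 (measurableSet_singleton z)))
  have h0 : {t : ℝ | (!₂[t, 0] : Point 2) ∈ {x : Point 2 | OnLines m z x}ᶜ} ∩
      Set.Icc (0 : ℝ) m = ∅ := by
    ext t; simp [OnLines]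
  have h1 : {t : ℝ | (!₂[t, z] : Point 2) ∈ {x : Point 2 | OnLines m z x}ᶜ} ∩
      Set.Icc (0 : ℝ) m = ∅ := by
    ext t; simp [OnLines]
  rw [ae_iff]
  change intervalsDist m z {x : Point 2 | OnLines m z x}ᶜ = 0
  rw [intervalsDist_apply m z hm.compl, h0, h1]
  simp

theorem intervalsDist_sphere (m : ℕ) (z : ℝ) (y : Point 2) (r : ℝ) :
    intervalsDist m z {x | dist y x = r} = 0 := by
  have hm : MeasurableSet {x : Point 2 | dist y x = r} :=
    (measurable_const.dist measurable_id) (measurableSet_singleton r)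
  have h (b : ℝ) : volume ({t : ℝ | (!₂[t, b] : Point 2) ∈ {x : Point 2 | dist y x = r}} ∩
      Set.Icc (0 : ℝ) m) = 0 := by
    set d := Real.sqrt (r ^ 2 - (y 1 - b) ^ 2)
    refine Set.Finite.measure_zero (Set.Finite.subset (Set.toFinite {y 0 - d, y 0 + d}) ?_) _
    rintro t ⟨ht, -⟩
    change dist y !₂[t, b] = r at ht
    have h1 : (y 0 - t) ^ 2 + (y 1 - b) ^ 2 = r ^ 2 := by
      rw [← ht, EuclideanSpace.dist_eq, Real.sq_sqrt (by positivity)]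
      simp [Fin.sum_univ_two, Real.dist_eq, sq_abs]
    have h2 : d ^ 2 = (y 0 - t) ^ 2 := by
      rw [Real.sq_sqrt (by rw [← h1]; nlinarith [sq_nonneg (y 0 - t)])]; linarith
    rcases sq_eq_sq_iff_eq_or_eq_neg.1 h2 with h3 | h3
    · left; linarith
    · right; simp only [Set.mem_singleton_iff]; linarith
  rw [intervalsDist_apply m z hm, h, h]
  simp

instance (m : ℕ) (z : ℝ) : IsFiniteMeasure (intervalsDist m z) := by
  refine ⟨?_⟩
  rw [intervalsDist_apply m z .univ]
  rcases Nat.eq_zero_or_pos m with rfl | hm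
  · simp
  · refine ENNReal.mul_lt_top (by simp; omega) (ENNReal.add_lt_top.2 ⟨?_, ?_⟩) <;>
    exact (measure_mono Set.inter_subset_right).trans_lt measure_Icc_lt_top

/-- By Fubini, with all points but `S k` fixed, a tie forces `S k` onto a circle around `y`, which
is a null set. -/
theorem ae_dist_ne {n : ℕ} (ν : Measure (Point 2)) [IsFiniteMeasure ν]
    {y : Point 2} (h : ∀ r, ν {x | dist y x = r} = 0) {k j : Fin n} (hkj : k ≠ j) :
    ∀ᵐ S ∂Measure.pi fun _ : Fin n => ν, dist y (S k) ≠ dist y (S j) := by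
  obtain ⟨n, rfl⟩ : ∃ l, n = l + 1 := ⟨n - 1, by have := k.pos; omega⟩
  obtain ⟨l, rfl⟩ := Fin.exists_succAbove_eq hkj.symm
  have hmp := measurePreserving_piFinSuccAbove (fun _ : Fin (n + 1) => ν) k
  set E : Set (Point 2 × (Fin n → Point 2)) := {q | dist y q.1 = dist y (q.2 l)}
  have hE : MeasurableSet E :=
    measurableSet_eq_fun (measurable_const.dist measurable_fst)
      (measurable_const.dist ((measurable_pi_apply l).comp measurable_snd))
  have h0 : (ν.prod (Measure.pi fun _ : Fin n => ν)) E = 0 := by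
    rw [Measure.prod_apply_symm hE]
    simp only [E, Set.preimage_ofPred_eq, h, lintegral_zero]
  rw [ae_iff]
  have := hmp.measure_preimage hE.nullMeasurableSet
  rw [h0] at this
  convert this using 2
  ext S
  simp [E, MeasurableEquiv.piFinSuccAbove, Fin.insertNthEquiv, Fin.removeNth]

section learn

variable {m n : ℕ} {hm : 0 < m} {z : ℝ} {A : LearningAlgorithm 2} {S : Fin n → Point 2}

theorem intervalsTask_truth {x : Point 2} (hx : OnLines m z x) :
    (intervalsTask m hm z).truth x = if x 1 = 0 then -1 else 1 := by
  have hiff : x ∈ segment ℝ (!₂[0, 0] : Point 2) !₂[(m : ℝ), 0] ↔ x 1 = 0 := by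
    constructor
    · rintro ⟨a, b, -, -, -, rfl⟩
      simp
    · intro h
      have hm' : (0 : ℝ) < m := by exact_mod_cast hm
      refine ⟨1 - x 0 / m, x 0 / m, ?_, div_nonneg hx.1.1 hm'.le, by ring, ?_⟩
      · rw [sub_nonneg, div_le_one hm']; exact hx.1.2
      · ext k
        fin_cases k
        · simp [hm'.ne']
        · simp [h]
  simp only [intervalsTask, hiff]

theorem exists_learn_eq (hA : IsOneNN A) (hn : 0 < n) (hS : ∀ k, OnLines m z (S k))
    (y : Point 2) : ∃ i, (∀ j, dist y (S i) ≤ dist y (S j)) ∧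
      (intervalsTask m hm z).learn A S y = if S i 1 = 0 then -1 else 1 := by
  obtain ⟨i, hi, h⟩ := hA n (fun i => (S i, (intervalsTask m hm z).truth (S i))) y hn
  exact ⟨i, hi, h.trans (intervalsTask_truth (hm := hm) (hS i))⟩

/-- Since `canon` resolves ties in favour of `1`, its label `-1` means a strict win of the lower
line. No tie-breaking rule can change it, so this holds at every `y`, also one chosen after seeing
answers. -/
theorem learn_eq_neg_one (hA : IsOneNN A) (hn : 0 < n)
    (hS : ∀ k, OnLines m z (S k)) {y : Point 2} (h : canon z S y = -1) :
    (intervalsTask m hm z).learn A S y = -1 := by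
  obtain ⟨i, hi, h'⟩ := exists_learn_eq (hm := hm) hA hn hS y
  rw [h']
  rcases (hS i).2 with h0 | h0
  · rw [if_pos h0]
  · obtain ⟨j, -, hj⟩ := canon_eq_neg_one.1 h i h0
    exact absurd (hi j) (not_le.2 hj)

theorem learn_eq_one (hA : IsOneNN A) (hn : 0 < n)
    (hS : ∀ k, OnLines m z (S k)) {y : Point 2}
    (h : ∃ k, S k 1 = z ∧ ∀ j, S j 1 = 0 → dist y (S k) < dist y (S j)) :
    (intervalsTask m hm z).learn A S y = 1 := by
  obtain ⟨i, hi, h'⟩ := exists_learn_eq (hm := hm) hA hn hS y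
  obtain ⟨k, -, hk⟩ := h
  rw [h', if_neg fun h0 => (hk i h0).not_ge (hi k)]

theorem ae_forall_onLines (m : ℕ) (z : ℝ) (n : ℕ) :
    ∀ᵐ S ∂Measure.pi fun _ : Fin n => intervalsDist m z, ∀ k, OnLines m z (S k) :=
  Filter.eventually_all.2 fun _ => (Measure.tendsto_eval_ae_ae).eventually (ae_onLines m z)

theorem ae_learn_eq_canon (hA : IsOneNN A) (hn : 0 < n) (hz : 0 < z) (y : Point 2) :
    ∀ᵐ S ∂Measure.pi fun _ : Fin n => intervalsDist m z,
      (intervalsTask m hm z).learn A S y = canon z S y := by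
  have h : ∀ᵐ S ∂Measure.pi fun _ : Fin n => intervalsDist m z,
      ∀ k j, k ≠ j → dist y (S k) ≠ dist y (S j) :=
    Filter.eventually_all.2 fun k => Filter.eventually_all.2 fun j => by
      by_cases hkj : k = j
      · simp [hkj]
      · simpa [hkj] using ae_dist_ne _ (intervalsDist_sphere m z y) hkj
  filter_upwards [h, ae_forall_onLines m z n] with S h hS
  by_cases hc : canon z S y = 1
  · rw [hc]
    refine learn_eq_one hA hn hS ?_
    obtain ⟨k, hk, hkj⟩ := canon_eq_one.1 hc
    refine ⟨k, hk, fun j hj => (hkj j hj).lt_of_ne (h k j ?_)⟩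
    rintro rfl
    exact hz.ne' (hk.symm.trans hj)
  · have hc' := (Int.units_eq_one_or _).resolve_left hc
    rw [hc', learn_eq_neg_one hA hn hS hc']

/-- The decision tree contains finitely many query points, all fixed in advance, so almost sure
agreement at each of them suffices. -/
theorem ae_run_learn_eq {ε : ℝ} (𝒜 : Adversary 2 ε) (hA : IsOneNN A) (hn : 0 < n) (hz : 0 < z) :
    ∀ᵐ S ∂Measure.pi fun _ : Fin n => intervalsDist m z,
      𝒜.run ((intervalsTask m hm z).learn A S) = 𝒜.run (canon z S) := by
  induction 𝒜 with
  | output p => simp [Adversary.run]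
  | ask x yes no ih1 ih2 =>
    filter_upwards [ih1, ih2, ae_learn_eq_canon (hm := hm) hA hn hz x] with S h1 h2 h3
    simp only [Adversary.run, h1, h2, h3]

end learn

/-! ### Measurability of the events and of the loss -/

section measurability

variable {n K : ℕ} {s ε : ℝ}

theorem measurableSet_canon {α : Type*} [MeasurableSpace α] (z : ℝ) {f : α → Fin n → Point 2}
    (hf : Measurable f) {g : α → Point 2} (hg : Measurable g) :
    MeasurableSet {a | canon z (f a) (g a) = 1} := by
  have hk (k : Fin n) : Measurable fun a => f a k := (measurable_pi_apply k).comp hf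
  simp only [canon_eq_one, Set.ofPred_exists, Set.ofPred_and, Set.ofPred_forall]
  refine .iUnion fun k => ((measurable_coord 1).comp (hk k) (measurableSet_singleton z)).inter
    (.iInter fun j => ?_)
  simp only [imp_iff_not_or, Set.ofPred_or]
  exact ((measurable_coord 1).comp (hk j) (measurableSet_singleton 0)).compl.union
    (measurableSet_le (hg.dist (hk k)) (hg.dist (hk j)))

theorem measurable_run (z : ℝ) (𝒜 : Adversary 2 ε) :
    Measurable fun q : (Fin n → Point 2) × Point 2 => (𝒜.run (canon z q.1)).toFun q.2 := by
  induction 𝒜 with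
  | output p => exact p.measurable.comp measurable_snd
  | ask x yes no ih1 ih2 =>
    have : (fun q : (Fin n → Point 2) × Point 2 =>
        ((Adversary.ask x yes no).run (canon z q.1)).toFun q.2) =
        fun q => if canon z q.1 x = 1 then (yes.run (canon z q.1)).toFun q.2
          else (no.run (canon z q.1)).toFun q.2 := by
      ext1 q; simp only [Adversary.run]; split_ifs <;> rfl
    rw [this]
    exact Measurable.ite (measurableSet_canon z measurable_fst measurable_const) ih1 ih2

theorem measurableSet_forall_queried (z : ℝ) (P : Point 2 → Prop) (𝒜 : Adversary 2 ε) :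
    MeasurableSet {S : Fin n → Point 2 | ∀ x ∈ 𝒜.queried (canon z S), P x} := by
  induction 𝒜 with
  | output p => simp [Adversary.queried]
  | ask x yes no ih1 ih2 =>
    have hx : MeasurableSet {S : Fin n → Point 2 | canon z S x = 1} :=
      measurableSet_canon z measurable_id measurable_const
    have : {S : Fin n → Point 2 | ∀ y ∈ (Adversary.ask x yes no).queried (canon z S), P y} =
        {_S | P x} ∩ Set.ite {S | canon z S x = 1}
          {S : Fin n → Point 2 | ∀ x ∈ yes.queried (canon z S), P x}
          {S : Fin n → Point 2 | ∀ x ∈ no.queried (canon z S), P x} := by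
      ext S
      simp only [Adversary.queried, List.mem_cons, forall_eq_or_imp, Set.mem_ofPred_eq,
        Set.mem_inter_iff, Set.ite, Set.mem_union, Set.mem_sdiff]
      split_ifs with h <;> simp [h]
    rw [this]
    exact (MeasurableSet.const _).inter (hx.ite ih1 ih2)

theorem measurableSet_occupied (s : ℝ) (i : ℤ) (y lo hi : ℝ) :
    MeasurableSet {S : Fin n → Point 2 | Occupied s S i y lo hi} := by
  simp only [Occupied, Set.ofPred_exists, Set.ofPred_and]
  have hk (k : Fin n) (l : Fin 2) : Measurable fun S : Fin n → Point 2 => S k l :=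
    (measurable_coord l).comp (measurable_pi_apply k)
  have ho (k : Fin n) := (measurable_offset s i).comp (hk k 0)
  exact .iUnion fun k => (hk k 1 (measurableSet_singleton y)).inter
    ((measurableSet_le measurable_const (ho k)).inter (measurableSet_le (ho k) measurable_const))

theorem measurableSet_good (s : ℝ) (i : ℤ) :
    MeasurableSet {S : Fin n → Point 2 | Good s S i} := by
  have ho := measurableSet_occupied (n := n) s i
  have hk (k : Fin n) (l : Fin 2) : Measurable fun S : Fin n → Point 2 => S k l :=
    (measurable_coord l).comp (measurable_pi_apply k)
  have hf (k : Fin n) := ((measurable_offset s i).comp (hk k 0)).abs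
  have hg : MeasurableSet {S : Fin n → Point 2 | ∀ k, S k 1 = 0 → |offset s i (S k 0)| < 101 * s →
      87 * s ≤ |offset s i (S k 0)| ∧ |offset s i (S k 0)| ≤ 89 * s} := by
    simp only [Set.ofPred_forall, imp_iff_not_or, Set.ofPred_or]
    exact .iInter fun k => (hk k 1 (measurableSet_singleton 0)).compl.union
      ((measurableSet_lt (hf k) measurable_const).compl.union
        ((measurableSet_le measurable_const (hf k)).inter
          (measurableSet_le (hf k) measurable_const)))
  have : {S : Fin n → Point 2 | Good s S i} =
      {S | Occupied s S i 0 (-103) (-101)} ∩ ({S | Occupied s S i 0 101 103} ∩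
      ({S | Occupied s S i (100 * s) (-9) (-5)} ∩ ({S | Occupied s S i (100 * s) 5 9} ∩
      ({S | ∀ k, S k 1 = 0 → |offset s i (S k 0)| < 101 * s →
        87 * s ≤ |offset s i (S k 0)| ∧ |offset s i (S k 0)| ≤ 89 * s} ∩
      (({S | Occupied s S i 0 (-89) (-87)} ∩ {S | Occupied s S i 0 87 89}ᶜ) ∪
        ({S | Occupied s S i 0 (-89) (-87)}ᶜ ∩ {S | Occupied s S i 0 87 89})))))) := by
    ext S
    exact ⟨fun h => ⟨h.1, h.2, h.3, h.4, h.5, h.6⟩,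
      fun h => ⟨h.1, h.2.1, h.2.2.1, h.2.2.2.1, h.2.2.2.2.1, h.2.2.2.2.2⟩⟩
  rw [this]
  exact (ho _ _ _).inter ((ho _ _ _).inter ((ho _ _ _).inter ((ho _ _ _).inter (hg.inter
    (((ho _ _ _).inter (ho _ _ _).compl).union ((ho _ _ _).compl.inter (ho _ _ _)))))))

theorem measurableSet_mem_freshGood (s : ℝ) (K : ℕ) (𝒜 : Adversary 2 ε) (i : ℤ) :
    MeasurableSet {S : Fin n → Point 2 | i ∈ freshGood s K 𝒜 S} := by
  simp only [mem_freshGood, Set.ofPred_and]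
  exact (MeasurableSet.const _ |>.inter (MeasurableSet.const _)).inter
    ((measurableSet_good s i).inter (measurableSet_forall_queried _ _ 𝒜))

theorem measurableSet_freshGood_eq (s : ℝ) (K : ℕ) (𝒜 : Adversary 2 ε) (V : Finset ℤ) :
    MeasurableSet {S : Fin n → Point 2 | freshGood s K 𝒜 S = V} := by
  simp only [Finset.ext_iff, Set.ofPred_forall]
  refine .iInter fun i => ?_
  by_cases hi : i ∈ V
  · simpa [hi] using measurableSet_mem_freshGood s K 𝒜 i
  · simp only [hi, iff_false]
    exact (measurableSet_mem_freshGood s K 𝒜 i).compl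

/-- The points of the lower line close to the midpoint of a window of `V`. -/
def targetSet (s : ℝ) (V : Finset ℤ) : Set (Point 2) :=
  {x | windowIndex s (x 0) ∈ V ∧ x 1 = 0 ∧ |offset s (windowIndex s (x 0)) (x 0)| ≤ 7 / 10 * s}

/-- The points at risk, in windows without a query, at which the adversary misses. -/
def lossSet (s : ℝ) (K : ℕ) (𝒜 : Adversary 2 ε) (S : Fin n → Point 2) : Set (Point 2) :=
  targetSet s (freshGood s K 𝒜 S) ∩
    {x | canon (100 * s) S ((𝒜.run (canon (100 * s) S)).toFun x) = -1}

theorem measurableSet_lossSet_prod (s : ℝ) (K : ℕ) (𝒜 : Adversary 2 ε) :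
    MeasurableSet {q : (Fin n → Point 2) × Point 2 | q.2 ∈ lossSet s K 𝒜 q.1} := by
  have : {q : (Fin n → Point 2) × Point 2 | q.2 ∈ lossSet s K 𝒜 q.1} =
      (⋃ i : ℤ, Prod.fst ⁻¹' {S | i ∈ freshGood s K 𝒜 S} ∩
        Prod.snd ⁻¹' {x : Point 2 | windowIndex s (x 0) = i ∧ x 1 = 0 ∧
          |offset s i (x 0)| ≤ 7 / 10 * s}) ∩
      {q : (Fin n → Point 2) × Point 2 |
        canon (100 * s) q.1 ((𝒜.run (canon (100 * s) q.1)).toFun q.2) = 1}ᶜ := by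
    ext ⟨S, x⟩
    have hu : ∀ u : Label, u = -1 ↔ ¬u = 1 := fun u => by
      rcases Int.units_eq_one_or u with rfl | rfl <;> decide
    simp [lossSet, targetSet, hu]
  rw [this]
  refine (MeasurableSet.iUnion fun i => ((measurable_fst (measurableSet_mem_freshGood s K 𝒜 i)).inter
    (measurable_snd ?_))).inter
      (measurableSet_canon _ measurable_fst (measurable_run _ 𝒜)).compl
  exact ((measurable_windowIndex s).comp (measurable_coord 0) (measurableSet_singleton i)).inter
    ((measurable_coord 1 (measurableSet_singleton 0)).inter
      (measurableSet_le ((measurable_offset s i).comp (measurable_coord 0)).abs measurable_const))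

theorem measurableSet_lossSet (s : ℝ) (K : ℕ) (𝒜 : Adversary 2 ε) (S : Fin n → Point 2) :
    MeasurableSet (lossSet s K 𝒜 S) :=
  measurable_prodMk_left (x := S) (measurableSet_lossSet_prod s K 𝒜)

theorem measurable_measure_lossSet (ν : Measure (Point 2)) [SFinite ν] (s : ℝ) (K : ℕ)
    (𝒜 : Adversary 2 ε) : Measurable fun S : Fin n → Point 2 => ν (lossSet s K 𝒜 S) :=
  measurable_measure_prodMk_left (measurableSet_lossSet_prod s K 𝒜)

end measurability

/-! ### Occupancy patterns and the second moment method -/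

/-- The samples with no point in `A` and with a point in every set of `Bs`. -/
def pattern {α : Type*} (n : ℕ) (A : Set α) (Bs : List (Set α)) : Set (Fin n → α) :=
  {S | (∀ k, S k ∉ A) ∧ ∀ B ∈ Bs, ∃ k, S k ∈ B}

/-- The probability of a pattern, in terms of the probabilities of its sets. -/
def patternProb (n : ℕ) : ℝ → List ℝ → ℝ
  | a, [] => (1 - a) ^ n
  | a, b :: l => patternProb n a l - patternProb n (a + b) l

section pattern

variable {α : Type*} {n : ℕ} {A : Set α} {Bs : List (Set α)}

/-- This is the inclusion-exclusion step behind `patternProb`: the samples that miss `B` are those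
whose forbidden set grows to `A ∪ B`. -/
theorem pattern_cons (B : Set α) :
    pattern n A (B :: Bs) = pattern n A Bs \ pattern n (A ∪ B) Bs := by
  ext S
  simp only [pattern, List.mem_cons, forall_eq_or_imp, Set.mem_ofPred_eq, Set.mem_sdiff,
    Set.mem_union, not_or, not_and, forall_and]
  constructor
  · rintro ⟨h1, ⟨k, hk⟩, h2⟩
    exact ⟨⟨h1, h2⟩, fun h _ => h.2 k hk⟩
  · rintro ⟨⟨h1, h2⟩, h3⟩
    refine ⟨h1, ?_, h2⟩
    by_contra! hc
    exact h3 ⟨h1, hc⟩ h2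

theorem pattern_append {A' : Set α} {Bs' : List (Set α)} :
    pattern n (A ∪ A') (Bs ++ Bs') = pattern n A Bs ∩ pattern n A' Bs' := by
  ext S
  simp only [pattern, List.mem_append, Set.mem_ofPred_eq, Set.mem_inter_iff, Set.mem_union, not_or,
    forall_and, or_imp]
  tauto

variable [MeasurableSpace α]

theorem measurableSet_pattern (hA : MeasurableSet A) (hBs : ∀ B ∈ Bs, MeasurableSet B) :
    MeasurableSet (pattern n A Bs) := by
  induction Bs generalizing A with
  | nil =>
    simp only [pattern, List.not_mem_nil, false_imp_iff, implies_true, and_true, Set.ofPred_forall]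
    exact .iInter fun k => (measurable_pi_apply k hA).compl
  | cons B l ih =>
    simp only [List.mem_cons, forall_eq_or_imp] at hBs
    rw [pattern_cons]
    exact (ih hA hBs.2).diff (ih (hA.union hBs.1) hBs.2)

theorem measureReal_pattern (ν : Measure α) [IsProbabilityMeasure ν] (hA : MeasurableSet A)
    (hBs : ∀ B ∈ Bs, MeasurableSet B) (hd : Bs.Pairwise Disjoint) (hAd : ∀ B ∈ Bs, Disjoint A B) :
    (Measure.pi fun _ : Fin n => ν).real (pattern n A Bs) =
      patternProb n (ν.real A) (Bs.map ν.real) := by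
  induction Bs generalizing A with
  | nil =>
    have : pattern n A [] = Set.univ.pi fun _ => Aᶜ := by ext S; simp [pattern]
    rw [this, Measure.real, Measure.pi_pi, ENNReal.toReal_prod]
    rw [List.map_nil, patternProb, ← probReal_compl_eq_one_sub hA]
    simp [Measure.real]
  | cons B l ih =>
    simp only [List.mem_cons, forall_eq_or_imp, List.pairwise_cons] at hBs hd hAd
    rw [pattern_cons, measureReal_sdiff _ (measurableSet_pattern (hA.union hBs.1) hBs.2),
      ih hA hBs.2 hd.2 hAd.2, ih (hA.union hBs.1) hBs.2 hd.2, List.map_cons, patternProb,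
      measureReal_union hAd.1 hBs.1]
    · exact fun C hC => (hAd.2 C hC).union_left (hd.1 C hC)
    · exact fun S hS => ⟨fun k hk => hS.1 k (.inl hk), hS.2⟩

/-- This is the Poisson limit: cells of mean `b` become independent, each occupied with probability
`1 - exp (-b)`. -/
theorem tendsto_patternProb (a : ℝ) (l : List ℝ) :
    Filter.Tendsto (fun n : ℕ => patternProb n (a / n) (l.map (· / (n : ℝ)))) Filter.atTop
      (nhds (Real.exp (-a) * (l.map fun b => 1 - Real.exp (-b)).prod)) := by
  induction l generalizing a with
  | nil =>
    simp only [patternProb, List.map_nil, List.prod_nil, mul_one]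
    simpa [sub_eq_add_neg, neg_div] using Real.tendsto_one_add_div_pow_exp (-a)
  | cons b l ih =>
    simp only [patternProb, List.map_cons, List.prod_cons]
    have := (ih a).sub (ih (a + b))
    simp only [add_div] at this
    convert this using 2
    rw [neg_add, Real.exp_add]; ring

end pattern

open Classical in
/-- A second moment bound for the number of events that occur. -/
theorem measureReal_card_filter_lt {Ω ι : Type*} [MeasurableSpace Ω] (μ : Measure Ω)
    [IsProbabilityMeasure μ] (I : Finset ι) (F : ι → Set Ω) (hF : ∀ i ∈ I, MeasurableSet (F i))
    {p q g : ℝ} (hp : ∀ i ∈ I, μ.real (F i) = p)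
    (hq : ∀ i ∈ I, ∀ j ∈ I, i ≠ j → μ.real (F i ∩ F j) = q) (hq0 : 0 ≤ q) (hg : 0 < g)
    (hI : 0 < I.card) :
    μ.real {S | ((I.filter fun i => S ∈ F i).card : ℝ) < g * I.card / 2} ≤
      4 / g ^ 2 * (p / I.card + q - 2 * g * p + g ^ 2) := by
  set k : ℝ := (I.card : ℝ)
  have hk : 0 < k := Nat.cast_pos.2 hI
  have hN (S : Ω) : ((I.filter fun i => S ∈ F i).card : ℝ) = ∑ i ∈ I, (F i).indicator 1 S := by
    simp [Set.indicator_apply]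
  have hint : ∀ i ∈ I, Integrable ((F i).indicator (1 : Ω → ℝ)) μ := fun i hi =>
    (integrable_const (1 : ℝ)).indicator (hF i hi)
  have hint2 : ∀ i ∈ I, ∀ j ∈ I, Integrable ((F i ∩ F j).indicator (1 : Ω → ℝ)) μ :=
    fun i hi j hj => (integrable_const (1 : ℝ)).indicator ((hF i hi).inter (hF j hj))
  -- The deviation is measured from `g * k` rather than from the mean, so the final bound tends to
  -- `0` as soon as `p → g`, `q → g ^ 2` and `k → ∞`.
  set f : Ω → ℝ := fun S => (∑ i ∈ I, (F i).indicator 1 S - g * k) ^ 2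
  have hf : f = fun S => (∑ i ∈ I, ∑ j ∈ I, (F i ∩ F j).indicator 1 S) -
      2 * g * k * (∑ i ∈ I, (F i).indicator 1 S) + g ^ 2 * k ^ 2 := by
    ext S
    have : ∀ i j, (F i ∩ F j).indicator (1 : Ω → ℝ) S =
        (F i).indicator 1 S * (F j).indicator 1 S := fun i j => by
      rw [Set.inter_indicator_one]; rfl
    simp only [f, this, ← Finset.sum_mul_sum]
    ring
  have hi1 : Integrable (fun S => ∑ i ∈ I, ∑ j ∈ I, (F i ∩ F j).indicator (1 : Ω → ℝ) S) μ :=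
    integrable_finsetSum _ fun i hi => integrable_finsetSum _ fun j hj => hint2 i hi j hj
  have hi2 : Integrable (fun S => 2 * g * k * ∑ i ∈ I, (F i).indicator (1 : Ω → ℝ) S) μ :=
    (integrable_finsetSum _ fun i hi => hint i hi).const_mul _
  have hi3 : Integrable (fun S => (∑ i ∈ I, ∑ j ∈ I, (F i ∩ F j).indicator (1 : Ω → ℝ) S) -
      2 * g * k * ∑ i ∈ I, (F i).indicator (1 : Ω → ℝ) S) μ := hi1.sub hi2
  have hfi : Integrable f μ := by
    rw [hf]; exact hi3.add (integrable_const _)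
  have hs2 : ∑ i ∈ I, ∑ j ∈ I, μ.real (F i ∩ F j) ≤ k * p + k ^ 2 * q := by
    -- On the diagonal the term is `p`; adding `q` there as well is harmless because `0 ≤ q`.
    calc ∑ i ∈ I, ∑ j ∈ I, μ.real (F i ∩ F j) ≤ ∑ i ∈ I, ∑ j ∈ I, ((if i = j then p else 0) + q) := by
          refine Finset.sum_le_sum fun i hi => Finset.sum_le_sum fun j hj => ?_
          split_ifs with h
          · subst h; rw [Set.inter_self, hp i hi]; linarith
          · rw [hq i hi j hj h]; linarith
      _ = k * p + k ^ 2 * q := by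
          simp [Finset.sum_add_distrib, Finset.sum_ite_eq]; ring
  have hfint : ∫ S, f S ∂μ ≤ k * p + k ^ 2 * q - 2 * g * k * (k * p) + g ^ 2 * k ^ 2 := by
    rw [hf]
    beta_reduce
    rw [integral_add hi3 (integrable_const _), integral_sub hi1 hi2,
      integral_finsetSum _ fun i hi => integrable_finsetSum _ fun j hj => hint2 i hi j hj,
      integral_const_mul, integral_finsetSum _ hint]
    have h1 : ∑ i ∈ I, ∫ S, (F i).indicator (1 : Ω → ℝ) S ∂μ = k * p := by
      rw [Finset.sum_congr rfl fun i hi => by rw [integral_indicator_one (hF i hi), hp i hi]]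
      simp [k]
    have h2 : ∑ i ∈ I, ∫ S, ∑ j ∈ I, (F i ∩ F j).indicator (1 : Ω → ℝ) S ∂μ =
        ∑ i ∈ I, ∑ j ∈ I, μ.real (F i ∩ F j) := by
      refine Finset.sum_congr rfl fun i hi => ?_
      rw [integral_finsetSum _ fun j hj => hint2 i hi j hj]
      exact Finset.sum_congr rfl fun j hj => integral_indicator_one ((hF i hi).inter (hF j hj))
    rw [h1, h2]
    simpa using hs2
  have hmk := mul_meas_ge_le_integral_of_nonneg (μ := μ) (f := f)
    (.of_forall fun S => sq_nonneg _) hfi ((g * k / 2) ^ 2)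
  have hsub : {S | ((I.filter fun i => S ∈ F i).card : ℝ) < g * k / 2} ⊆
      {S | (g * k / 2) ^ 2 ≤ f S} := by
    intro S hS
    rw [Set.mem_ofPred_eq, hN] at hS
    rw [Set.mem_ofPred_eq]
    simp only [f]
    rw [← neg_sq (_ - _)]
    exact pow_le_pow_left₀ (by positivity) (by linarith) 2
  refine (measureReal_mono hsub).trans ?_
  have hpos : 0 < (g * k / 2) ^ 2 := by positivity
  rw [← mul_le_mul_iff_right₀ hpos]
  refine (hmk.trans hfint).trans (le_of_eq ?_)
  field_simp
  ring

/-! ### Good windows are frequent -/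

/-- The points at height `y` with offset from `lo` to `hi` in the window `i`. -/
def cell (s : ℝ) (i : ℤ) (y lo hi : ℝ) : Set (Point 2) :=
  {x | x 1 = y ∧ lo * s ≤ offset s i (x 0) ∧ offset s i (x 0) ≤ hi * s}

/-- The part of the lower line without sample points when the left cluster is present. -/
def gapSet (s : ℝ) (i : ℤ) : Set (Point 2) :=
  {x | x 1 = 0 ∧ |offset s i (x 0)| < 101 * s ∧
    ¬(-89 * s ≤ offset s i (x 0) ∧ offset s i (x 0) ≤ -87 * s)}

/-- The cells that hold sample points when the left cluster is present. -/
def goodCells (s : ℝ) (i : ℤ) : List (Set (Point 2)) :=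
  [cell s i 0 (-103) (-101), cell s i 0 101 103, cell s i (100 * s) (-9) (-5),
    cell s i (100 * s) 5 9, cell s i 0 (-89) (-87)]

section cells

variable {s : ℝ} {i j : ℤ} {m K : ℕ}

theorem good_of_mem_pattern (hs : 0 < s) {n : ℕ} {S : Fin n → Point 2}
    (h : S ∈ pattern n (gapSet s i) (goodCells s i)) : Good s S i := by
  obtain ⟨h1, h2⟩ := h
  simp only [goodCells, List.mem_cons, List.not_mem_nil, or_false, forall_eq_or_imp,
    forall_eq] at h2
  obtain ⟨ha, hb, hc, hd, he⟩ := h2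
  refine ⟨ha, hb, hc, hd, fun k hk hlt => ?_, .inl ⟨he, ?_⟩⟩
  · by_contra hn
    refine h1 k ⟨hk, hlt, fun hc => hn ?_⟩
    rw [abs_of_nonpos (by linarith)]
    constructor <;> linarith
  · rintro ⟨k, hk, hk1, hk2⟩
    refine h1 k ⟨hk, ?_, fun hc => ?_⟩
    · rw [abs_of_nonneg (by linarith)]; linarith
    · linarith

theorem measurableSet_cell (s : ℝ) (i : ℤ) (y lo hi : ℝ) : MeasurableSet (cell s i y lo hi) := by
  have ho := (measurable_offset s i).comp (measurable_coord 0)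
  exact (measurable_coord 1 (measurableSet_singleton y)).inter
    ((measurableSet_le measurable_const ho).inter (measurableSet_le ho measurable_const))

theorem measurableSet_gapSet (s : ℝ) (i : ℤ) : MeasurableSet (gapSet s i) := by
  have ho := (measurable_offset s i).comp (measurable_coord 0)
  exact (measurable_coord 1 (measurableSet_singleton 0)).inter
    ((measurableSet_lt ho.abs measurable_const).inter
      ((measurableSet_le measurable_const ho).inter (measurableSet_le ho measurable_const)).compl)

theorem measurableSet_of_mem_goodCells {B : Set (Point 2)} (h : B ∈ goodCells s i) :
    MeasurableSet B := by
  simp only [goodCells, List.mem_cons, List.not_mem_nil, or_false] at h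
  rcases h with rfl | rfl | rfl | rfl | rfl <;> exact measurableSet_cell _ _ _ _ _

theorem windowIndex_of_mem_cell (hs : 0 < s) {y lo hi : ℝ} (hlo : -105 ≤ lo) (hhi : hi < 105)
    {x : Point 2} (h : x ∈ cell s i y lo hi) : windowIndex s (x 0) = i :=
  (windowIndex_eq_iff hs).2 ⟨by nlinarith [h.2.1], by nlinarith [h.2.2]⟩

theorem windowIndex_of_mem_gapSet (hs : 0 < s) {x : Point 2} (h : x ∈ gapSet s i) :
    windowIndex s (x 0) = i := by
  have := abs_lt.1 h.2.1
  exact (windowIndex_eq_iff hs).2 ⟨by linarith, by linarith⟩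

theorem windowIndex_of_mem_goodCells (hs : 0 < s) {B : Set (Point 2)} (h : B ∈ goodCells s i)
    {x : Point 2} (hx : x ∈ B) : windowIndex s (x 0) = i := by
  simp only [goodCells, List.mem_cons, List.not_mem_nil, or_false] at h
  rcases h with rfl | rfl | rfl | rfl | rfl <;>
    exact windowIndex_of_mem_cell hs (by norm_num) (by norm_num) hx

theorem disjoint_cell (hs : 0 < s) {y y' lo hi lo' hi' : ℝ}
    (h : y ≠ y' ∨ hi < lo' ∨ hi' < lo) : Disjoint (cell s i y lo hi) (cell s i y' lo' hi') := by
  rw [Set.disjoint_left]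
  rintro x ⟨h1, h2, h3⟩ ⟨h1', h2', h3'⟩
  rcases h with h | h | h
  · exact h (h1.symm.trans h1')
  · nlinarith
  · nlinarith

theorem pairwise_goodCells (hs : 0 < s) : (goodCells s i).Pairwise Disjoint := by
  have h0 : (0 : ℝ) ≠ 100 * s := by positivity
  simp only [goodCells, List.pairwise_cons, List.mem_cons, List.not_mem_nil, or_false,
    forall_eq_or_imp, forall_eq, false_imp_iff, implies_true, List.Pairwise.nil, and_true]
  refine ⟨⟨?_, ?_, ?_, ?_⟩, ⟨?_, ?_, ?_⟩, ⟨?_, ?_⟩, ?_⟩ <;> refine disjoint_cell hs ?_ <;>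
    first | exact .inl h0 | exact .inl h0.symm | (right; norm_num)

theorem disjoint_gapSet_of_mem_goodCells (hs : 0 < s) {B : Set (Point 2)}
    (h : B ∈ goodCells s i) : Disjoint (gapSet s i) B := by
  rw [Set.disjoint_left]
  rintro x ⟨h1, h2, h3⟩ hx
  rw [abs_lt] at h2
  simp only [goodCells, List.mem_cons, List.not_mem_nil, or_false] at h
  rcases h with rfl | rfl | rfl | rfl | rfl
  · linarith [hx.2.2]
  · linarith [hx.2.1]
  · have := hx.1; rw [h1] at this; linarith
  · have := hx.1; rw [h1] at this; linarith
  · exact h3 hx.2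

theorem mem_Icc_of_windowIndex (hs : 0 < s) (hK : K * (210 * s) ≤ m) {t : ℝ}
    (h0 : 0 ≤ windowIndex s t) (h1 : windowIndex s t < K) : t ∈ Set.Icc (0 : ℝ) m := by
  obtain ⟨h2, h3⟩ := (windowIndex_eq_iff hs).1 (rfl : windowIndex s t = _)
  simp only [offset, windowCenter] at h2 h3
  have h0' : (0 : ℝ) ≤ windowIndex s t := by exact_mod_cast h0
  have h1' : (windowIndex s t : ℝ) + 1 ≤ K := by exact_mod_cast h1
  constructor <;> nlinarith

theorem intervalsDist_real_line {z y : ℝ} (hz : 0 < z) (hy : y = 0 ∨ y = z) {E : Set ℝ}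
    (hE : MeasurableSet E) (hEI : E ⊆ Set.Icc (0 : ℝ) m) :
    (intervalsDist m z).real {x | x 1 = y ∧ x 0 ∈ E} = volume.real E / (2 * m) := by
  have hme : MeasurableSet {x : Point 2 | x 1 = y ∧ x 0 ∈ E} :=
    (measurable_coord 1 (measurableSet_singleton y)).inter (measurable_coord 0 hE)
  have hin : volume (E ∩ Set.Icc (0 : ℝ) m) = volume E := by rw [Set.inter_eq_left.2 hEI]
  rw [Measure.real, intervalsDist_apply m z hme, ENNReal.toReal_mul]
  have : (2 * (m : ENNReal))⁻¹.toReal = (2 * (m : ℝ))⁻¹ := by simp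
  rw [this, div_eq_inv_mul]
  congr 1
  rcases hy with rfl | rfl
  · simp [hz.ne', hin, Measure.real]
  · simp [hz.ne, hin, Measure.real]

theorem measureReal_cell (hs : 0 < s) (hK : K * (210 * s) ≤ m) (h0 : 0 ≤ i) (h1 : i < K)
    {y lo hi : ℝ} (hy : y = 0 ∨ y = 100 * s) (hlo : -105 ≤ lo) (hhi : hi < 105) (hle : lo ≤ hi) :
    (intervalsDist m (100 * s)).real (cell s i y lo hi) = (hi - lo) * s / (2 * m : ℕ) := by
  have he : cell s i y lo hi = {x | x 1 = y ∧ x 0 ∈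
      Set.Icc (windowCenter s i + lo * s) (windowCenter s i + hi * s)} := by
    ext x
    simp only [cell, offset, Set.mem_ofPred_eq, Set.mem_Icc]
    refine and_congr_right fun _ => ?_
    constructor <;> rintro ⟨h1, h2⟩ <;> constructor <;> linarith
  rw [he, intervalsDist_real_line (by positivity) hy measurableSet_Icc]
  · rw [Real.volume_real_Icc_of_le (by nlinarith)]
    push_cast
    ring
  · intro t ht
    have : windowIndex s t = i := (windowIndex_eq_iff hs).2
      ⟨by simp only [offset]; nlinarith [ht.1], by simp only [offset]; nlinarith [ht.2]⟩
    exact mem_Icc_of_windowIndex hs hK (this ▸ h0) (this ▸ h1)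

theorem measureReal_gapSet (hs : 0 < s) (hK : K * (210 * s) ≤ m) (h0 : 0 ≤ i)
    (h1 : i < K) :
    (intervalsDist m (100 * s)).real (gapSet s i) = 200 * s / (2 * m : ℕ) := by
  set c := windowCenter s i
  have he : gapSet s i = {x | x 1 = 0 ∧ x 0 ∈
      Set.Ioo (c - 101 * s) (c + 101 * s) \ Set.Icc (c - 89 * s) (c - 87 * s)} := by
    ext x
    simp only [gapSet, offset, Set.mem_ofPred_eq, Set.mem_Icc, Set.mem_Ioo, Set.mem_sdiff, abs_lt]
    refine and_congr_right fun _ => and_congr ?_ (not_congr ?_) <;>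
    constructor <;> rintro ⟨h1, h2⟩ <;> constructor <;> linarith
  rw [he, intervalsDist_real_line (by positivity) (.inl rfl)
    (measurableSet_Ioo.diff measurableSet_Icc)]
  · rw [measureReal_sdiff (Set.Icc_subset_Ioo (by linarith) (by linarith)) measurableSet_Icc
      measure_Ioo_lt_top.ne, Real.volume_real_Icc_of_le (by linarith),
      Real.volume_real_Ioo_of_le (by linarith)]
    push_cast
    ring
  · intro t ht
    have : windowIndex s t = i := (windowIndex_eq_iff hs).2
      ⟨by simp only [offset]; linarith [ht.1.1], by simp only [offset]; linarith [ht.1.2]⟩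
    exact mem_Icc_of_windowIndex hs hK (this ▸ h0) (this ▸ h1)

end cells

/-- The expected numbers of sample points in the good cells of a window. -/
def cellMasses (s : ℝ) : List ℝ := [2 * s, 2 * s, 4 * s, 4 * s, 2 * s]

theorem map_measureReal_goodCells {s : ℝ} {i : ℤ} {m K : ℕ} (hs : 0 < s)
    (hK : K * (210 * s) ≤ m) (h0 : 0 ≤ i) (h1 : i < K) :
    (goodCells s i).map (intervalsDist m (100 * s)).real =
      (cellMasses s).map (· / ((2 * m : ℕ) : ℝ)) := by
  have h {y lo hi : ℝ} := measureReal_cell (y := y) (lo := lo) (hi := hi) hs hK h0 h1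
  simp only [goodCells, cellMasses, List.map_cons, List.map_nil]
  rw [h, h, h, h, h] <;> norm_num

/-- The limit probability that a window is good, with its cluster on the left. -/
def goodRate (s : ℝ) : ℝ :=
  Real.exp (-(200 * s)) * ((cellMasses s).map fun b => 1 - Real.exp (-b)).prod

theorem goodRate_pos {s : ℝ} (hs : 0 < s) : 0 < goodRate s := by
  refine mul_pos (Real.exp_pos _) (List.prod_pos ?_)
  intro x hx
  obtain ⟨b, hb, rfl⟩ := List.mem_map.1 hx
  have hb0 : 0 < b := by
    simp only [cellMasses, List.mem_cons, List.not_mem_nil, or_false] at hb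
    rcases hb with rfl | rfl | rfl | rfl | rfl <;> positivity
  rw [sub_pos, Real.exp_lt_one_iff]
  linarith

-- Counting only windows with the cluster on the left makes each event a `pattern` of explicit
-- probability. Two windows are disjoint, so their joint event is again a pattern, and its limit `g
-- * g` shows asymptotic independence. The second moment bound then tends to `0`.
open Classical in
theorem eventually_card_good {s : ℝ} (hs : 0 < s) :
    ∀ᶠ m : ℕ in Filter.atTop, (Measure.pi fun _ : Fin (2 * m) => intervalsDist m (100 * s)).real
      {S | (((Finset.Ico 0 (⌊(m : ℝ) / (210 * s)⌋₊ : ℤ)).filter fun i => Good s S i).card : ℝ) <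
        goodRate s * ⌊(m : ℝ) / (210 * s)⌋₊ / 2} ≤ 1 / 10 := by
  set g := goodRate s
  have hg : 0 < g := goodRate_pos hs
  set p : ℕ → ℝ := fun n => patternProb n (200 * s / n) ((cellMasses s).map (· / (n : ℝ)))
  set q : ℕ → ℝ := fun n => patternProb n ((200 * s + 200 * s) / n)
    ((cellMasses s ++ cellMasses s).map (· / (n : ℝ)))
  have h2 : Filter.Tendsto (fun m : ℕ => 2 * m) Filter.atTop Filter.atTop :=
    Filter.tendsto_id.const_mul_atTop' (by norm_num)
  have hp : Filter.Tendsto (fun m => p (2 * m)) Filter.atTop (nhds g) :=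
    (tendsto_patternProb _ _).comp h2
  have hq : Filter.Tendsto (fun m => q (2 * m)) Filter.atTop (nhds (g * g)) := by
    have := (tendsto_patternProb (200 * s + 200 * s) (cellMasses s ++ cellMasses s)).comp h2
    rw [List.map_append, List.prod_append, neg_add, Real.exp_add, mul_mul_mul_comm] at this
    exact this
  have hKt : Filter.Tendsto (fun m : ℕ => ⌊(m : ℝ) / (210 * s)⌋₊) Filter.atTop Filter.atTop :=
    tendsto_nat_floor_atTop.comp
      (tendsto_natCast_atTop_atTop.atTop_div_const (by positivity))
  have hlim : Filter.Tendsto (fun m : ℕ => 4 / g ^ 2 * (p (2 * m) / (⌊(m : ℝ) / (210 * s)⌋₊ : ℝ) +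
      q (2 * m) - 2 * g * p (2 * m) + g ^ 2)) Filter.atTop (nhds 0) := by
    have := ((((hp.div_atTop (tendsto_natCast_atTop_atTop.comp hKt)).add hq).sub
      (hp.const_mul (2 * g))).add_const (g ^ 2)).const_mul (4 / g ^ 2)
    rwa [show 4 / g ^ 2 * (0 + g * g - 2 * g * g + g ^ 2) = 0 by ring] at this
  filter_upwards [hlim.eventually_le_const (show (0 : ℝ) < 1 / 10 by norm_num),
    hq.eventually_const_lt (mul_pos hg hg), hKt.eventually_gt_atTop 0,
    Filter.eventually_gt_atTop 0] with m hle hq0 hKpos hm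
  refine le_trans ?_ hle
  set K := ⌊(m : ℝ) / (210 * s)⌋₊
  have hK : K * (210 * s) ≤ m := by
    rw [← le_div_iff₀ (by positivity)]
    exact Nat.floor_le (by positivity)
  have := intervalsDist_isProb m hm (100 * s)
  set ν := intervalsDist m (100 * s)
  set I := Finset.Ico 0 (K : ℤ)
  set F : ℤ → Set (Fin (2 * m) → Point 2) := fun i => pattern (2 * m) (gapSet s i) (goodCells s i)
  have hF (i : ℤ) : MeasurableSet (F i) :=
    measurableSet_pattern (measurableSet_gapSet s i) fun _ h => measurableSet_of_mem_goodCells h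
  have hFp : ∀ i ∈ I, (Measure.pi fun _ : Fin (2 * m) => ν).real (F i) = p (2 * m) := by
    intro i hi
    rw [Finset.mem_Ico] at hi
    rw [measureReal_pattern ν (measurableSet_gapSet s i)
      (fun _ h => measurableSet_of_mem_goodCells h) (pairwise_goodCells hs)
      (fun _ h => disjoint_gapSet_of_mem_goodCells hs h),
      map_measureReal_goodCells hs hK hi.1 hi.2, measureReal_gapSet hs hK hi.1 hi.2]
  have hFq : ∀ i ∈ I, ∀ j ∈ I, i ≠ j →
      (Measure.pi fun _ : Fin (2 * m) => ν).real (F i ∩ F j) = q (2 * m) := by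
    intro i hi j hj hij
    rw [Finset.mem_Ico] at hi hj
    have hd {B C : Set (Point 2)} (hB : ∀ x ∈ B, windowIndex s (x 0) = i)
        (hC : ∀ x ∈ C, windowIndex s (x 0) = j) : Disjoint B C :=
      Set.disjoint_left.2 fun x hx hx' => hij ((hB x hx).symm.trans (hC x hx'))
    have hgi (i : ℤ) : ∀ x ∈ gapSet s i, windowIndex s (x 0) = i :=
      fun x hx => windowIndex_of_mem_gapSet hs hx
    have hci (i : ℤ) : ∀ B ∈ goodCells s i, ∀ x ∈ B, windowIndex s (x 0) = i :=
      fun B hB x hx => windowIndex_of_mem_goodCells hs hB hx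
    rw [← pattern_append, measureReal_pattern ν
      ((measurableSet_gapSet s i).union (measurableSet_gapSet s j)), List.map_append,
      map_measureReal_goodCells hs hK hi.1 hi.2, map_measureReal_goodCells hs hK hj.1 hj.2,
      measureReal_union (hd (hgi i) (hgi j)) (measurableSet_gapSet s j),
      measureReal_gapSet hs hK hi.1 hi.2, measureReal_gapSet hs hK hj.1 hj.2, ← add_div,
      ← List.map_append]
    · intro B hB
      rcases List.mem_append.1 hB with h | h <;> exact measurableSet_of_mem_goodCells h
    · rw [List.pairwise_append]
      exact ⟨pairwise_goodCells hs, pairwise_goodCells hs,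
        fun B hB C hC => hd (hci i B hB) (hci j C hC)⟩
    · intro B hB
      rcases List.mem_append.1 hB with h | h
      · exact (disjoint_gapSet_of_mem_goodCells hs h).union_left (hd (hci i B h) (hgi j)).symm
      · exact (hd (hgi i) (hci j B h)).union_left (disjoint_gapSet_of_mem_goodCells hs h)
  have hcard : I.card = K := by simp [I]
  have hbound := measureReal_card_filter_lt (Measure.pi fun _ : Fin (2 * m) => ν) I F
    (fun i _ => hF i) hFp hFq hq0.le hg (by rwa [hcard])
  rw [hcard] at hbound
  refine le_trans (measureReal_mono fun S hS => ?_) hbound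
  refine lt_of_le_of_lt ?_ (Set.mem_ofPred_eq ▸ hS)
  exact_mod_cast Finset.card_le_card
    (Finset.monotone_filter_right I fun i _ hi => good_of_mem_pattern hs hi)

/-! ### The loss of the adversary under reflection -/

theorem measureReal_targetSet {s : ℝ} {m K : ℕ} (hs : 0 < s) (hK : K * (210 * s) ≤ m)
    {V : Finset ℤ} (hV : ∀ i ∈ V, 0 ≤ i ∧ i < K) :
    (intervalsDist m (100 * s)).real (targetSet s V) = V.card * (7 / 5 * s / (2 * m)) := by
  have he : targetSet s V = ⋃ i ∈ V, cell s i 0 (-(7 / 10)) (7 / 10) := by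
    ext x
    simp only [targetSet, Set.mem_ofPred_eq, Set.mem_iUnion, exists_prop]
    constructor
    · rintro ⟨h1, h2, h3⟩
      rw [abs_le] at h3
      exact ⟨_, h1, h2, by linarith, h3.2⟩
    · rintro ⟨i, hi, hx⟩
      rw [windowIndex_of_mem_cell hs (by norm_num) (by norm_num) hx]
      exact ⟨hi, hx.1, abs_le.2 ⟨by linarith [hx.2.1], hx.2.2⟩⟩
  rw [he, measureReal_biUnion_finset (fun i _ j _ hij => Set.disjoint_left.2 fun x hx hx' => hij
    ((windowIndex_of_mem_cell hs (by norm_num) (by norm_num) hx).symm.trans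
      (windowIndex_of_mem_cell hs (by norm_num) (by norm_num) hx')))
    (fun i _ => measurableSet_cell _ _ _ _ _),
    Finset.sum_congr rfl fun i hi => measureReal_cell hs hK (hV i hi).1 (hV i hi).2 (.inl rfl)
      (by norm_num) (by norm_num) (by norm_num)]
  simp only [Finset.sum_const, nsmul_eq_mul]
  push_cast
  ring

section loss

variable {m n K : ℕ} {s ε : ℝ} {S : Fin n → Point 2} {𝒜 : Adversary 2 ε} {V : Finset ℤ}

/-- The sample and its reflection face the same output perturbation and have the same target set, so
the pointwise alternative in each good window applies. -/
theorem targetSet_subset_lossSet_union (hs : 0 < s) (hε : ε ≤ 10 * s)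
    (hV : freshGood s K 𝒜 S = V) :
    targetSet s V ⊆ lossSet s K 𝒜 S ∪ lossSet s K 𝒜 (flipSample s V S) := by
  intro x hx
  rw [lossSet, lossSet, freshGood_flip hs hV, (run_flip hs hV).1, hV]
  have hg : Good s S (windowIndex s (x 0)) := (mem_freshGood.1 (hV ▸ hx.1)).2.1
  rcases hg.canon_eq_neg_one_or hs hx.1 hx.2.1 hx.2.2
    (((𝒜.run (canon (100 * s) S)).bound x).trans hε) with h | h
  · exact .inl ⟨hx, h⟩
  · exact .inr ⟨hx, h⟩

theorem measurePreserving_flipSample (hs : 0 < s) (hK : K * (210 * s) ≤ m)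
    (hV : ∀ i ∈ V, 0 ≤ i ∧ i < (K : ℤ)) :
    MeasurePreserving (flipSample (n := n) s V) (Measure.pi fun _ => intervalsDist m (100 * s))
      (Measure.pi fun _ => intervalsDist m (100 * s)) :=
  measurePreserving_pi _ _ fun _ => measurePreserving_flip hs (by positivity) V m fun t ht =>
    mem_Icc_of_windowIndex hs hK (hV _ ht).1 (hV _ ht).2

/-- Given the fresh good windows, the loss is small with probability at most one half. -/
theorem two_mul_measure_loss_lt (hs : 0 < s) (hε : ε ≤ 10 * s) (hK : K * (210 * s) ≤ m)
    (𝒜 : Adversary 2 ε) (hV : ∀ i ∈ V, 0 ≤ i ∧ i < (K : ℤ)) {δ : ℝ}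
    (hδ : 2 * δ ≤ V.card * (7 / 5 * s / (2 * m))) :
    2 * (Measure.pi fun _ : Fin n => intervalsDist m (100 * s)).real
        {S | freshGood s K 𝒜 S = V ∧ (intervalsDist m (100 * s)).real (lossSet s K 𝒜 S) < δ} ≤
      (Measure.pi fun _ : Fin n => intervalsDist m (100 * s)).real {S | freshGood s K 𝒜 S = V} := by
  set ν := intervalsDist m (100 * s)
  set μ := Measure.pi fun _ : Fin n => ν
  set B : Set (Fin n → Point 2) := {S | freshGood s K 𝒜 S = V ∧ ν.real (lossSet s K 𝒜 S) < δ}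
  have hB : MeasurableSet B := (measurableSet_freshGood_eq s K 𝒜 V).inter
    (measurableSet_lt (measurable_measure_lossSet ν s K 𝒜).ennreal_toReal measurable_const)
  have hmp : MeasurePreserving (flipSample (n := n) s V) μ μ :=
    measurePreserving_flipSample hs hK hV
  -- If the sample and its reflection both had loss below `δ`, the target set would have mass below
  -- `2 * δ`.
  have hd : Disjoint B (flipSample s V ⁻¹' B) := by
    rw [Set.disjoint_left]
    rintro S ⟨h1, h2⟩ ⟨-, h3⟩
    have := (measureReal_mono (targetSet_subset_lossSet_union hs hε h1)
      (measure_ne_top ν _)).trans (measureReal_union_le _ _)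
    rw [measureReal_targetSet hs hK hV] at this
    linarith
  have hsub : B ∪ flipSample s V ⁻¹' B ⊆ {S | freshGood s K 𝒜 S = V} := by
    rintro S (h | h)
    · exact h.1
    · have := freshGood_flip hs h.1
      rwa [flipSample_flipSample hs] at this
  calc 2 * μ.real B = μ.real B + μ.real (flipSample s V ⁻¹' B) := by
        rw [hmp.measureReal_preimage hB.nullMeasurableSet, two_mul]
    _ = μ.real (B ∪ flipSample s V ⁻¹' B) := (measureReal_union hd (hmp.measurable hB)).symm
    _ ≤ _ := measureReal_mono hsub

/-- The adversary loses the measure of `lossSet` against the adversarial risk. -/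
theorem advRiskOf_add_loss_le {hm : 0 < m} {A : LearningAlgorithm 2} (hA : IsOneNN A) (hn : 0 < n)
    (hs : 0 < s) (hε : 10 * s ≤ ε) (hS : ∀ k, OnLines m (100 * s) (S k))
    (hrun : 𝒜.run ((intervalsTask m hm (100 * s)).learn A S) = 𝒜.run (canon (100 * s) S)) :
    advRiskOf (intervalsTask m hm (100 * s)) ((intervalsTask m hm (100 * s)).learn A S)
        (𝒜.run ((intervalsTask m hm (100 * s)).learn A S)) +
      (intervalsDist m (100 * s)).real (lossSet s K 𝒜 S) ≤
    advRisk (intervalsTask m hm (100 * s)) ((intervalsTask m hm (100 * s)).learn A S) ε := by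
  set T := intervalsTask m hm (100 * s)
  set f := T.learn A S
  set N : Set (Point 2) := {x | OnLines m (100 * s) x}
  have hae : ∀ᵐ x ∂intervalsDist m (100 * s), x ∈ N := ae_onLines m (100 * s)
  rw [hrun, advRisk, advRiskOf]
  set p := 𝒜.run (canon (100 * s) S)
  set H : Set (Point 2) := {x | f (p.toFun x) ≠ T.truth x}
  set L := lossSet s K 𝒜 S
  set R : Set (Point 2) := {x | ∃ γ : Point 2, ‖γ‖ ≤ ε ∧ f (x + γ) ≠ T.truth x}
  change (intervalsDist m (100 * s)).real H + _ ≤ (intervalsDist m (100 * s)).real R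
  set ν := intervalsDist m (100 * s)
  have hHR : H ⊆ R := fun x hx => ⟨p.toFun x - x, p.bound x, by
    rw [add_sub_cancel]; exact hx⟩
  have hLR : L ∩ N ⊆ R := by
    rintro x ⟨⟨hx, -⟩, hxN⟩
    obtain ⟨y, hy, hk⟩ := (mem_freshGood.1 hx.1).2.1.exists_near hs hx.2.1 hx.2.2
    refine ⟨y - x, hy.trans hε, ?_⟩
    have hy1 : f y = 1 := learn_eq_one hA hn hS hk
    rw [add_sub_cancel, hy1, intervalsTask_truth hxN, if_pos hx.2.1]
    decide
  have hLH : Disjoint (L ∩ N) H := by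
    rw [Set.disjoint_left]
    rintro x ⟨⟨hx, hx'⟩, hxN⟩ hxH
    refine hxH ?_
    rw [intervalsTask_truth hxN, if_pos hx.2.1]
    exact learn_eq_neg_one hA hn hS hx'
  -- Restricting to the lines, where the ground truth is known, costs only a null set.
  have hLN : (L ∩ N : Set (Point 2)) =ᵐ[ν] L :=
    inter_ae_eq_left_of_ae_eq_univ (Filter.eventuallyEq_univ.2 hae)
  have hLm : NullMeasurableSet (L ∩ N) ν :=
    (measurableSet_lossSet s K 𝒜 S).nullMeasurableSet.congr hLN.symm
  have : ν.real (H ∪ L ∩ N) = ν.real H + ν.real (L ∩ N) :=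
    measureReal_union₀ hLm hLH.symm.aedisjoint
  rw [← measureReal_congr hLN, ← this]
  exact measureReal_mono (Set.union_subset hHR hLR)

end loss

/-! ### Few queries are not enough -/

open Classical in
/-- Few queries leave, with probability at least `4 / 10`, a loss of at least `δ`. -/
theorem measureReal_loss_lt_le {m n K : ℕ} (hm : 0 < m) {s ε : ℝ} (hs : 0 < s) (hε : ε ≤ 10 * s)
    (hK : K * (210 * s) ≤ m) (𝒜 : Adversary 2 ε) {g δ : ℝ}
    (hgood : (Measure.pi fun _ : Fin n => intervalsDist m (100 * s)).real
      {S | (((Finset.Ico 0 (K : ℤ)).filter fun i => Good s S i).card : ℝ) < g} ≤ 1 / 10)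
    (hδ : 2 * δ ≤ (g - 𝒜.queries) * (7 / 5 * s / (2 * m))) :
    (Measure.pi fun _ : Fin n => intervalsDist m (100 * s)).real
      {S | (intervalsDist m (100 * s)).real (lossSet s K 𝒜 S) < δ} ≤ 6 / 10 := by
  have := intervalsDist_isProb m hm (100 * s)
  set ν := intervalsDist m (100 * s)
  set μ := Measure.pi fun _ : Fin n => ν
  -- These are the fresh sets that remain possible when at least `g` windows are good. Their events
  -- are disjoint, so the conditional bounds of one half can be summed.
  set W := (Finset.Ico 0 (K : ℤ)).powerset.filter fun V => g ≤ V.card + 𝒜.queries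
  set E : Finset ℤ → Set (Fin n → Point 2) := fun V => {S | freshGood s K 𝒜 S = V}
  set B : Finset ℤ → Set (Fin n → Point 2) := fun V =>
    {S | freshGood s K 𝒜 S = V ∧ ν.real (lossSet s K 𝒜 S) < δ}
  have hsub : {S | ν.real (lossSet s K 𝒜 S) < δ} ⊆
      {S | (((Finset.Ico 0 (K : ℤ)).filter fun i => Good s S i).card : ℝ) < g} ∪ ⋃ V ∈ W, B V := by
    intro S hS
    by_cases hg : (((Finset.Ico 0 (K : ℤ)).filter fun i => Good s S i).card : ℝ) < g
    · exact .inl hg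
    · refine .inr (Set.mem_biUnion (x := freshGood s K 𝒜 S) ?_ ⟨rfl, hS⟩)
      refine Finset.mem_coe.2 (Finset.mem_filter.2
        ⟨Finset.mem_powerset.2 fun i hi => by simpa using (mem_freshGood.1 hi).1, (not_lt.1 hg).trans ?_⟩)
      exact_mod_cast card_filter_good_le s K 𝒜 S
  have hBE : ∀ V ∈ W, μ.real (B V) ≤ 1 / 2 * μ.real (E V) := by
    intro V hV
    obtain ⟨hV, hc⟩ := Finset.mem_filter.1 hV
    have := two_mul_measure_loss_lt (n := n) hs hε hK 𝒜 (V := V) (δ := δ)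
      (fun i hi => by simpa using Finset.mem_powerset.1 hV hi)
      (hδ.trans (mul_le_mul_of_nonneg_right (by linarith) (by positivity)))
    linarith
  have hsum : ∑ V ∈ W, μ.real (E V) ≤ 1 := by
    rw [← measureReal_biUnion_finset (fun V _ V' _ h => Set.disjoint_left.2 fun S h1 h2 =>
      h (h1.symm.trans h2)) fun V _ => measurableSet_freshGood_eq s K 𝒜 V]
    exact measureReal_le_one
  calc _ ≤ _ := measureReal_mono hsub
    _ ≤ _ := measureReal_union_le _ _
    _ ≤ 1 / 10 + ∑ V ∈ W, μ.real (B V) := add_le_add hgood (measureReal_biUnion_finset_le _ _)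
    _ ≤ 1 / 10 + ∑ V ∈ W, 1 / 2 * μ.real (E V) := by gcongr with V hV; exact hBE V hV
    _ ≤ 6 / 10 := by rw [← Finset.mul_sum]; linarith

/-- An adversary that asks few queries does not succeed. -/
theorem not_succeeds {m : ℕ} {hm : 0 < m} {s lam : ℝ} (hs : 0 < s)
    (hlam : 0 < lam) (hlam' : lam < goodRate s / 4800)
    (hfloor : (m : ℝ) / (2 * (210 * s)) ≤ ⌊(m : ℝ) / (210 * s)⌋₊)
    (hgood : open Classical in
      (Measure.pi fun _ : Fin (2 * m) => intervalsDist m (100 * s)).real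
      {S | (((Finset.Ico 0 (⌊(m : ℝ) / (210 * s)⌋₊ : ℤ)).filter fun i => Good s S i).card : ℝ) <
        goodRate s * ⌊(m : ℝ) / (210 * s)⌋₊ / 2} ≤ 1 / 10)
    {A : LearningAlgorithm 2} (hA : IsOneNN A) (𝒜 : Adversary 2 (100 * s / 10))
    (hq : (𝒜.queries : ℝ) ≤ goodRate s / (8 * (210 * s)) * m) :
    ¬𝒜.Succeeds A (intervalsTask m hm (100 * s)) (2 * m) (1 - lam) 0.1 := by
  have := intervalsDist_isProb m hm (100 * s)
  set K := ⌊(m : ℝ) / (210 * s)⌋₊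
  have hK : K * (210 * s) ≤ m := by
    rw [← le_div_iff₀ (by positivity)]
    exact Nat.floor_le (by positivity)
  have hg := goodRate_pos hs
  have hm' : (0 : ℝ) < m := by exact_mod_cast hm
  -- At least `goodRate s * m / (4 * (210 * s))` windows are good and the queries spoil at most half
  -- that number. Each remaining window has target mass `7 / 5 * s / (2 * m)`, which gives `goodRate
  -- s / 2400` in all, twice `δ`.
  have hloss := measureReal_loss_lt_le hm hs (by linarith) hK 𝒜 (δ := goodRate s / 4800) hgood (by
    have h1 : goodRate s * (m / (2 * (210 * s))) ≤ goodRate s * K := by gcongr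
    have h2 : goodRate s / (8 * (210 * s)) * m ≤ goodRate s * K / 2 - 𝒜.queries := by
      have : goodRate s / (8 * (210 * s)) * m = goodRate s * (m / (2 * (210 * s))) / 4 := by
        field_simp; norm_num
      linarith
    calc 2 * (goodRate s / 4800) = goodRate s / (8 * (210 * s)) * m * (7 / 5 * s / (2 * m)) := by
          field_simp; norm_num
      _ ≤ _ := by gcongr)
  intro hsucc
  have hle : (Measure.pi fun _ : Fin (2 * m) => intervalsDist m (100 * s)).real
      {S | (1 - lam) * advRisk (intervalsTask m hm (100 * s))
          ((intervalsTask m hm (100 * s)).learn A S) (100 * s / 10) ≤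
        advRiskOf (intervalsTask m hm (100 * s)) ((intervalsTask m hm (100 * s)).learn A S)
          (𝒜.run ((intervalsTask m hm (100 * s)).learn A S))} ≤
      (Measure.pi fun _ : Fin (2 * m) => intervalsDist m (100 * s)).real
      {S | (intervalsDist m (100 * s)).real (lossSet s K 𝒜 S) < goodRate s / 4800} := by
    -- The success event may be nonmeasurable, but monotonicity up to null sets holds for arbitrary
    -- sets. Success forces the loss to be at most `lam` times the adversarial risk, hence at most
    -- `lam`.
    refine ENNReal.toReal_mono (measure_ne_top _ _) (measure_mono_ae ?_)
    filter_upwards [ae_forall_onLines m (100 * s) (2 * m),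
      ae_run_learn_eq (n := 2 * m) (hm := hm) 𝒜 hA (by omega) (show 0 < 100 * s by positivity)]
      with S hS hrun hSucc
    have h1 := advRiskOf_add_loss_le (K := K) hA (by omega) hs (by linarith) hS hrun
    have h2 : advRisk (intervalsTask m hm (100 * s))
        ((intervalsTask m hm (100 * s)).learn A S) (100 * s / 10) ≤ 1 :=
      measureReal_le_one (μ := intervalsDist m (100 * s))
    change (1 - lam) * _ ≤ _ at hSucc
    change (intervalsDist m (100 * s)).real (lossSet s K 𝒜 S) < goodRate s / 4800
    nlinarith
  have h9 := (hsucc.trans hle).trans hloss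
  norm_num at h9

end QueryComplexity
end

theorem theorem2 :
    ∃ lam : ℝ → ℝ, (∀ z, 0 < z → 0 < lam z ∧ lam z < 1) ∧
      ∃ z₀ : ℝ, 0 < z₀ ∧ ∀ z : ℝ, z₀ ≤ z →
        ∃ c : ℝ, 0 < c ∧ ∃ M : ℕ, ∀ (m : ℕ) (hm : 0 < m), M ≤ m →
          ∀ A : QueryComplexity.LearningAlgorithm 2, QueryComplexity.IsOneNN A →
            ENNReal.ofReal (c * m) ≤
              (QueryComplexity.QC A (QueryComplexity.intervalsTask m hm z) (2 * m) (z / 10)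
                (1 - lam z) 0.1 : ENNReal) := by
  -- The denominator `9600` puts `lam` strictly below the guaranteed loss `goodRate s / 4800`, and
  -- the bound `1 / 2` keeps it below `1`. The choice `z₀ = 1` serves only to make `z` positive.
  refine ⟨fun z => min (QueryComplexity.goodRate (z / 100) / 9600) (1 / 2), fun z hz =>
    ⟨lt_min (by have := QueryComplexity.goodRate_pos (show 0 < z / 100 by positivity); positivity)
      (by norm_num), (min_le_right _ _).trans_lt (by norm_num)⟩, 1, one_pos, fun z hz => ?_⟩
  obtain ⟨s, rfl⟩ : ∃ s, z = 100 * s := ⟨z / 100, by ring⟩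
  have hs : 0 < s := by linarith
  have hg := QueryComplexity.goodRate_pos hs
  beta_reduce
  rw [show 100 * s / 100 = s by ring]
  obtain ⟨M, hM⟩ := Filter.eventually_atTop.1 (QueryComplexity.eventually_card_good hs)
  -- The bound `⌈2 * (210 * s)⌉₊` makes `m / (210 * s)` at least `2`, so rounding down the number of
  -- windows loses at most half.
  refine ⟨QueryComplexity.goodRate s / (8 * (210 * s)), by positivity,
    max M ⌈2 * (210 * s)⌉₊, fun m hm hMm A hA => ?_⟩
  have hfloor : (m : ℝ) / (2 * (210 * s)) ≤ ⌊(m : ℝ) / (210 * s)⌋₊ := by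
    have h1 : 2 * (210 * s) ≤ m := Nat.ceil_le.1 ((le_max_right _ _).trans hMm)
    have h2 : 1 ≤ (m : ℝ) / (2 * (210 * s)) := by rwa [le_div_iff₀ (by positivity), one_mul]
    have h3 : (m : ℝ) / (210 * s) = 2 * (m / (2 * (210 * s))) := by field_simp
    have := Nat.lt_floor_add_one ((m : ℝ) / (210 * s))
    linarith
  have hmain : ((⌈QueryComplexity.goodRate s / (8 * (210 * s)) * m⌉₊ : ℕ) : ℕ∞) ≤
      QueryComplexity.QC A (QueryComplexity.intervalsTask m hm (100 * s)) (2 * m) (100 * s / 10)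
        (1 - min (QueryComplexity.goodRate s / 9600) (1 / 2)) 0.1 := by
    refine le_iInf₂ fun q hq => ?_
    obtain ⟨𝒜, hq, hsucc⟩ := hq
    rw [Nat.cast_le, Nat.ceil_le]
    by_contra! hlt
    refine QueryComplexity.not_succeeds hs (by positivity)
      ((min_le_left _ _).trans_lt (by linarith)) hfloor (hM m ((le_max_left _ _).trans hMm)) hA 𝒜
      ((Nat.cast_le.2 hq).trans hlt.le) hsucc
  calc ENNReal.ofReal (QueryComplexity.goodRate s / (8 * (210 * s)) * m)
      ≤ ((⌈QueryComplexity.goodRate s / (8 * (210 * s)) * m⌉₊ : ℕ) : ENNReal) := by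
        rw [← ENNReal.ofReal_natCast]
        exact ENNReal.ofReal_le_ofReal (Nat.le_ceil _)
    _ ≤ _ := by exact_mod_cast hmain
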